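/- Let $p$ be a prime, let $\mathbb{F}_q$ be a finite field of characteristic $p$, and let $\alpha\in\mathbb{F}_q^\times$ be such that $\mathbb{F}_p(\alpha)=\mathbb{F}_q$ and $\mathbb{F}_p(\alpha+\alpha^{-1})\neq\mathbb{F}_p(\alpha)$. Let $n\ge 1$, let $B_n$ be the braid group on $n$ strands with Artin generators $\sigma_1,\dots,\sigma_{n-1}$, and let $H_n(\alpha)$ be the Hecke algebra, that is, the quotient of the group algebra $\mathbb{F}_q B_n$ by the relations $(\sigma_i+1)(\sigma_i-\alpha)=0$ for $1\le i\le n-1$. Assume that $H_n(\alpha)$ is semisimple. Let $R:B_n\to \mathrm{GL}_N(\mathbb{F}_q)$ be any absolutely irreducible representation that factors through $H_n(\alpha)$ (in the semisimple case these are, up to isomorphism, the representations attached to the partitions $\lambda\vdash n$). Then $q$ is the square of a power of $p$, and there exists $P\in\mathrm{GL}_N(\mathbb{F}_q)$ such that $$P\,R(g)\,P^{-1}\in \mathrm{GU}_N(q^{1/2})\qquad\text{for all } g\in B_n,$$ where $\mathrm{GU}_N(q^{1/2})=\{A\in\mathrm{GL}_N(\mathbb{F}_q) : {}^t\varepsilon(A)\,A=1\}$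 and $\varepsilon$ is the map $x\mapsto x^{q^{1/2}}$ applied to each entry. -/

import Mathlib

open scoped MatrixGroups

/-- The defining relators of the braid group on `n` strands, in the generators
`σ_0, …, σ_{n-2}` (so there is no generator when `n ≤ 1`). -/
inductive BraidRelator (n : ℕ) : FreeGroup (Fin (n - 1)) → Prop
  /-- `σ_i σ_j σ_i = σ_j σ_i σ_j` for neighbouring `i` and `j`. -/
  | braid (i j : Fin (n - 1)) (h : (i : ℕ) + 1 = j) :
      BraidRelator n
        (FreeGroup.of i * FreeGroup.of j * FreeGroup.of i *
          (FreeGroup.of j * FreeGroup.of i * FreeGroup.of j)⁻¹)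
  /-- `σ_i σ_j = σ_j σ_i` when `i` and `j` are at distance at least two. -/
  | comm (i j : Fin (n - 1)) (h : (i : ℕ) + 2 ≤ j) :
      BraidRelator n
        (FreeGroup.of i * FreeGroup.of j * (FreeGroup.of j * FreeGroup.of i)⁻¹)

/-- The braid group `B_n` on `n` strands, by Artin's presentation. -/
abbrev BraidGroup (n : ℕ) : Type := PresentedGroup {r | BraidRelator n r}

namespace BraidGroup

/-- The Artin generator `σ_i` of the braid group. -/
def σ {n : ℕ} (i : Fin (n - 1)) : BraidGroup n := PresentedGroup.of i

end BraidGroup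

/-- The quadratic relations `(σ_i + 1)(σ_i - α) = 0` in the group algebra of `B_n`. -/
inductive HeckeRel (F : Type*) [Field F] (n : ℕ) (α : Fˣ) :
    MonoidAlgebra F (BraidGroup n) → MonoidAlgebra F (BraidGroup n) → Prop
  | quadratic (i : Fin (n - 1)) :
      HeckeRel F n α
        ((MonoidAlgebra.of F (BraidGroup n) (BraidGroup.σ i) + 1) *
          (MonoidAlgebra.of F (BraidGroup n) (BraidGroup.σ i) -
            algebraMap F (MonoidAlgebra F (BraidGroup n)) (α : F)))
        0

/-- The Hecke algebra `H_n(α)` of type `A_{n-1}` over `F`: the quotient of the group algebra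
`F B_n` by the relations `(σ_i + 1)(σ_i - α) = 0`. -/
abbrev HeckeAlgebra (F : Type*) [Field F] (n : ℕ) (α : Fˣ) : Type _ :=
  RingQuot (HeckeRel F n α)

/-- The image of a braid in the Hecke algebra. -/
noncomputable def HeckeAlgebra.ofBraid (F : Type*) [Field F] (n : ℕ) (α : Fˣ) :
    BraidGroup n →* HeckeAlgebra F n α :=
  ((RingQuot.mkAlgHom F (HeckeRel F n α) :
      MonoidAlgebra F (BraidGroup n) →ₐ[F] HeckeAlgebra F n α) :
      MonoidAlgebra F (BraidGroup n) →* HeckeAlgebra F n α).comp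
    (MonoidAlgebra.of F (BraidGroup n))

/-- A matrix representation `R` of `B_n` is a representation of the Hecke algebra `H_n(α)` if it
factors through the natural map from `B_n` to `H_n(α)`. -/
def IsHeckeRepresentation {F : Type*} [Field F] {n N : ℕ} (α : Fˣ)
    (R : BraidGroup n →* GL (Fin N) F) : Prop :=
  ∃ ρ : HeckeAlgebra F n α →ₐ[F] Matrix (Fin N) (Fin N) F,
    ∀ g : BraidGroup n, ρ (HeckeAlgebra.ofBraid F n α g) = (R g : Matrix (Fin N) (Fin N) F)

/-- The linear representation on `K^N` given by a homomorphism to `GL_N(K)`. -/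
noncomputable def matrixRepresentation {G K : Type*} [Group G] [Field K] {N : ℕ}
    (R : G →* GL (Fin N) K) : Representation K G (Fin N → K) :=
  (Matrix.toLinAlgEquiv' : Matrix (Fin N) (Fin N) K ≃ₐ[K] _).toMonoidHom.comp
    ((Units.coeHom (Matrix (Fin N) (Fin N) K)).comp R)

/-- `R : G → GL_N(F)` is absolutely irreducible if it is irreducible over an algebraic closure
of `F`. -/
def IsAbsolutelyIrreducible {G F : Type*} [Group G] [Field F] {N : ℕ}
    (R : G →* GL (Fin N) F) : Prop :=
  (matrixRepresentation
    ((Matrix.GeneralLinearGroup.map (algebraMap F (AlgebraicClosure F))).comp R)).IsIrreducible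

/-- The group of all `A ∈ GL_N(F)` with `ᵗε(A) A = 1`, where `ε` is applied to each entry. When
`F` has `q₀ ^ 2` elements and `ε` is `x ↦ x ^ q₀`, this is the general unitary group `GU_N(q₀)`
of the standard hermitian form. -/
def generalUnitaryGroup {F : Type*} [Field F] (N : ℕ) (ε : F →+* F) :
    Subgroup (GL (Fin N) F) where
  carrier := {A | ((A : Matrix (Fin N) (Fin N) F).map ε).transpose *
    (A : Matrix (Fin N) (Fin N) F) = 1}
  one_mem' := by simp
  mul_mem' := by
    intro A B hA hB
    simp only [Set.mem_ofPred_eq] at hA hB ⊢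
    rw [Units.val_mul, Matrix.map_mul, Matrix.transpose_mul, Matrix.mul_assoc,
      ← Matrix.mul_assoc _ (A : Matrix (Fin N) (Fin N) F), hA, Matrix.one_mul, hB]
  inv_mem' := by
    intro A hA
    simp only [Set.mem_ofPred_eq] at hA ⊢
    have h1 : (A : Matrix (Fin N) (Fin N) F) * ((A : Matrix (Fin N) (Fin N) F).map ε).transpose
        = 1 := mul_eq_one_comm.mp hA
    have h2 : ((A : Matrix (Fin N) (Fin N) F).map ε).transpose
        = ((A⁻¹ : GL (Fin N) F) : Matrix (Fin N) (Fin N) F) :=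
      (Units.inv_eq_of_mul_eq_one_right h1).symm
    have h3 : (((A⁻¹ : GL (Fin N) F) : Matrix (Fin N) (Fin N) F).map ε).transpose *
        ((A : Matrix (Fin N) (Fin N) F).map ε).transpose = 1 := by
      rw [← Matrix.transpose_mul, ← Matrix.map_mul, ← Units.val_mul]
      simp
    rwa [h2] at h3

/-!
The extension `F / F_p(α + α⁻¹)` is quadratic, and its nontrivial automorphism `ε` is
`x ↦ x ^ q₀` with `q₀ ^ 2 = q`; it exchanges the two roots `α`, `α⁻¹` of `X² - (α + α⁻¹) X + 1`
(`exists_iterateFrobenius_eq_inv`). Hence the conjugate dual `g ↦ ᵗε(R(g⁻¹))` of a representation of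
the Hecke algebra is again one (`exists_isConjugateDual`). The point is that an absolutely
irreducible `R` is equivalent to its conjugate dual; an intertwiner is then a nondegenerate invariant
sesquilinear form, which Schur's lemma makes hermitian after rescaling
(`exists_hermitian_invariant`), and over a finite field a nondegenerate hermitian form is equivalent
to the standard one (`exists_adj_mul_self_eq`).

For the equivalence it suffices, by Burnside's theorem and the Skolem-Noether theorem for matrix
algebras, that `R` and its conjugate dual have the same character (`exists_conj_of_trace_eq`). No
classification of the representations is needed. Semisimplicity forces the quantum integers
`[i] = 1 + α + ⋯ + α ^ (i - 1)` with `i ≤ n` to be nonzero, since otherwise the symmetrizer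
`∑ T_w` would span a nilpotent left ideal (`HeckeAlgebra.qInt_ne_zero`). So every parabolic
subalgebra contains a normalised symmetrizer, the idempotent on which its generators act by `α`.

A trace function that vanishes on all these idempotents is zero
(`IsHeckeFamily.trace_eq_zero`). By the decomposition `H_{k + 1} = H_k + H_k T_k H_k`, the Hecke
algebra is spanned modulo commutators by ordered products of distinct generators, and the relation
`[k + 2] e_{k + 1} = e_k + [k + 1] e_k T_k e_k` between consecutive symmetrizers turns such products
into products of symmetrizers of disjoint blocks. On such an idempotent `E` the conjugate dual takes
the value `ᵗε(R(E))` (`IsConjugateDual.map_blockIdempotent`), whose trace is that of `R(E)`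
because the trace of an idempotent matrix lies in the prime field. Therefore the difference of the
two characters vanishes on all of these idempotents, and the characters agree.
-/

/-! ### Hecke families and symmetrizers -/

/-- A sequence `T 0, …, T (m - 1)` of elements of an algebra satisfying the defining relations of
the Hecke algebra of type `A_m` with parameter `α`. The sequence is indexed by all of `ℕ`; its
terms of index at least `m` are irrelevant. -/
structure IsHeckeFamily {F A : Type*} [Field F] [Ring A] [Algebra F A] (α : F) (m : ℕ)
    (T : ℕ → A) : Prop where
  quad : ∀ i < m, T i * T i = (α - 1) • T i + α • 1
  braid : ∀ i, i + 1 < m → T i * T (i + 1) * T i = T (i + 1) * T i * T (i + 1)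
  comm : ∀ i j, i + 2 ≤ j → j < m → T i * T j = T j * T i

/-- The quantum integer `[k] = 1 + α + ⋯ + α ^ (k - 1)`. -/
def qInt {F : Type*} [Field F] (α : F) (k : ℕ) : F := ∑ i ∈ Finset.range k, α ^ i

/-- The sum `1 + T (a + k - 1) + T (a + k - 2) T (a + k - 1) + ⋯ + T a ⋯ T (a + k - 1)` over the
shortest left coset representatives of the symmetric group generated by the transpositions
`a, …, a + k - 2` in the one generated by `a, …, a + k - 1`. -/
def shuffle {A : Type*} [Ring A] (T : ℕ → A) (a : ℕ) : ℕ → A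
  | 0 => 1
  | k + 1 => 1 + shuffle T a k * T (a + k)

/-- The normalised symmetrizer of the parabolic subalgebra generated by `T a, …, T (a + k - 1)`,
that is, the idempotent on which each of these generators acts by `α`. It is defined by the
recursion `[k + 2] e_{k + 1} = e_k + [k + 1] e_k T_{a + k} e_k`, and it has this meaning as long
as the quantum integers involved do not vanish. -/
def blockSymmetrizer {F A : Type*} [Field F] [Ring A] [Algebra F A] (α : F) (T : ℕ → A) (a : ℕ) :
    ℕ → A
  | 0 => 1
  | k + 1 => (qInt α (k + 2))⁻¹ • (blockSymmetrizer α T a k + qInt α (k + 1) •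
      (blockSymmetrizer α T a k * T (a + k) * blockSymmetrizer α T a k))

section HeckeFamily

variable {F A : Type*} [Field F] [Ring A] [Algebra F A] {α : F} {m : ℕ} {T : ℕ → A}

theorem qInt_one : qInt α 1 = 1 := by simp [qInt]

theorem qInt_succ (k : ℕ) : qInt α (k + 1) = 1 + α * qInt α k := by
  rw [qInt, geom_sum_succ, qInt, add_comm]

namespace IsHeckeFamily

theorem commute (h : IsHeckeFamily α m T) {i j : ℕ} (hi : i < m) (hj : j < m)
    (hij : i + 2 ≤ j ∨ j + 2 ≤ i) : Commute (T i) (T j) := by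
  rcases hij with hij | hij
  · exact h.comm i j hij hj
  · exact (h.comm j i hij hi).symm

theorem op (h : IsHeckeFamily α m T) :
    IsHeckeFamily α m (fun i => MulOpposite.op (T i)) where
  quad i hi := by
    rw [← MulOpposite.op_mul, h.quad i hi]; simp
  braid i hi := by
    simp only [← MulOpposite.op_mul, ← mul_assoc, h.braid i hi]
  comm i j hij hj := by
    simp only [← MulOpposite.op_mul, h.comm i j hij hj]

end IsHeckeFamily

theorem commute_shuffle {x : A} {a k : ℕ} (hx : ∀ j, a ≤ j → j < a + k → Commute x (T j)) :
    Commute x (shuffle T a k) := by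
  induction k with
  | zero => exact Commute.one_right x
  | succ k ih =>
    exact (Commute.one_right x).add_right
      ((ih fun j h1 h2 => hx j h1 (by omega)).mul_right (hx _ (by omega) (by omega)))

theorem commute_blockSymmetrizer {x : A} {a k : ℕ}
    (hx : ∀ j, a ≤ j → j < a + k → Commute x (T j)) :
    Commute x (blockSymmetrizer α T a k) := by
  induction k with
  | zero => exact Commute.one_right x
  | succ k ih =>
    have h1 := ih fun j h1 h2 => hx j h1 (by omega)
    have h2 := hx (a + k) (by omega) (by omega)
    exact (h1.add_right (((h1.mul_right h2).mul_right h1).smul_right _)).smul_right _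

theorem op_blockSymmetrizer (a k : ℕ) :
    blockSymmetrizer α (fun i => MulOpposite.op (T i)) a k =
      MulOpposite.op (blockSymmetrizer α T a k) := by
  induction k with
  | zero => rfl
  | succ k ih => simp [blockSymmetrizer, ih, mul_assoc]

/-- Multiplication by the shuffle element turns a vector on which `T a, …, T (a + k - 1)` act
by `α` into one on which `T (a + k)` acts by `α` as well. -/
theorem mul_shuffle_mul (h : IsHeckeFamily α m T) (a k : ℕ) (hk : a + k < m) (v : A)
    (hv : ∀ j, a ≤ j → j < a + k → T j * v = α • v) :
    ∀ j, a ≤ j → j ≤ a + k → T j * (shuffle T a (k + 1) * v) = α • (shuffle T a (k + 1) * v) := by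
  induction k generalizing v with
  | zero =>
    intro j h1 h2
    obtain rfl : j = a := by omega
    have hq := h.quad j (by omega)
    simp only [shuffle, add_zero, one_mul, ← mul_assoc, mul_add, hq, add_mul, sub_mul,
      smul_mul_assoc, sub_smul, one_smul, smul_add]
    abel
  | succ k ih =>
    have hv' : ∀ j, a ≤ j → j < a + k → T j * (T (a + (k + 1)) * v) =
        α • (T (a + (k + 1)) * v) := fun j h1 h2 => by
      rw [← mul_assoc, h.comm j (a + (k + 1)) (by omega) hk, mul_assoc, hv j h1 (by omega),
        mul_smul_comm]
    have hS : shuffle T a (k + 1 + 1) * v = v + shuffle T a (k + 1) * (T (a + (k + 1)) * v) := by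
      rw [shuffle, add_mul, one_mul, mul_assoc]
    intro j h1 h2
    rw [hS, mul_add, smul_add]
    rcases Nat.lt_or_ge j (a + (k + 1)) with hj | hj
    · rw [hv j h1 hj, ih (by omega) _ hv' j h1 (by omega)]
    · obtain rfl : j = a + (k + 1) := by omega
      have hc : Commute (T (a + (k + 1))) (shuffle T a k) :=
        commute_shuffle fun j h1 h2 => h.commute hk (by omega) (by omega)
      have hb : T (a + (k + 1)) * (T (a + k) * (T (a + (k + 1)) * v)) =
          α • (T (a + k) * (T (a + (k + 1)) * v)) := by
        have := h.braid (a + k) (by omega)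
        rw [← mul_assoc, ← mul_assoc, ← add_assoc, ← this, mul_assoc, mul_assoc,
          hv (a + k) (by omega) (by omega), mul_smul_comm, mul_smul_comm]
      have hq : T (a + (k + 1)) * (T (a + (k + 1)) * v) =
          (α - 1) • (T (a + (k + 1)) * v) + α • v := by
        rw [← mul_assoc, h.quad _ hk, add_mul, smul_mul_assoc, smul_mul_assoc, one_mul]
      have e1 : shuffle T a (k + 1) * (T (a + (k + 1)) * v) = T (a + (k + 1)) * v +
          shuffle T a k * (T (a + k) * (T (a + (k + 1)) * v)) := by
        rw [shuffle, add_mul, one_mul, mul_assoc]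
      rw [e1, mul_add, hq, ← mul_assoc _ (shuffle T a k), hc.eq, mul_assoc (shuffle T a k), hb,
        mul_smul_comm, smul_add, sub_smul, one_smul]
      abel

theorem mul_shuffle {w : A} {a k : ℕ} (hw : ∀ j, a ≤ j → j < a + k → w * T j = α • w) :
    w * shuffle T a k = qInt α (k + 1) • w := by
  induction k with
  | zero => simp [shuffle, qInt_one]
  | succ k ih =>
    rw [shuffle, mul_add, mul_one, ← mul_assoc, ih fun j h1 h2 => hw j h1 (by omega),
      smul_mul_assoc, hw (a + k) (by omega) (by omega), qInt_succ (k + 1), add_smul, one_smul,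
      smul_smul, mul_comm]

theorem mul_blockSymmetrizer {w : A} {a k : ℕ} (hq : ∀ i, 0 < i → i ≤ k + 1 → qInt α i ≠ 0)
    (hw : ∀ j, a ≤ j → j < a + k → w * T j = α • w) :
    w * blockSymmetrizer α T a k = w := by
  induction k with
  | zero => simp [blockSymmetrizer]
  | succ k ih =>
    have ih := ih (fun i h1 h2 => hq i h1 (by omega)) fun j h1 h2 => hw j h1 (by omega)
    have hk := hw (a + k) (by omega) (by omega)
    rw [blockSymmetrizer, mul_smul_comm, mul_add, mul_smul_comm, ← mul_assoc, ← mul_assoc, ih, hk,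
      smul_mul_assoc, ih, smul_smul, ← one_smul F w, smul_smul, ← add_smul, smul_smul,
      mul_one, mul_comm (qInt α (k + 1)), ← qInt_succ,
      inv_mul_cancel₀ (hq _ (by omega) (by omega))]

theorem blockSymmetrizer_mul {w : A} {a k : ℕ} (hq : ∀ i, 0 < i → i ≤ k + 1 → qInt α i ≠ 0)
    (hw : ∀ j, a ≤ j → j < a + k → T j * w = α • w) :
    blockSymmetrizer α T a k * w = w := by
  have := mul_blockSymmetrizer (T := fun i => MulOpposite.op (T i)) (w := MulOpposite.op w)
    (a := a) hq (fun j h1 h2 => by rw [← MulOpposite.op_mul, hw j h1 h2]; simp)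
  rw [op_blockSymmetrizer, ← MulOpposite.op_mul] at this
  exact MulOpposite.op_injective this

/-- With `e` the symmetrizer of one generator less, `[k + 2]` times the new symmetrizer equals
`shuffle * e`, whence the generators act on it by `α`. -/
theorem IsHeckeFamily.mul_blockSymmetrizer_succ_of_absorb (h : IsHeckeFamily α m T) {a k : ℕ}
    (hk : a + k < m) (hq : ∀ i, 0 < i → i ≤ k + 1 → qInt α i ≠ 0)
    (hl : ∀ j, a ≤ j → j < a + k →
      T j * blockSymmetrizer α T a k = α • blockSymmetrizer α T a k)
    (hr : ∀ j, a ≤ j → j < a + k →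
      blockSymmetrizer α T a k * T j = α • blockSymmetrizer α T a k) :
    ∀ j, a ≤ j → j < a + (k + 1) →
      T j * blockSymmetrizer α T a (k + 1) = α • blockSymmetrizer α T a (k + 1) := by
  set e := blockSymmetrizer α T a k with he
  have hS := mul_shuffle_mul h a k hk e hl
  have h1 : e * (shuffle T a (k + 1) * e) = shuffle T a (k + 1) * e :=
    blockSymmetrizer_mul hq fun j h1 h2 => hS j h1 h2.le
  have h2 : e * (shuffle T a (k + 1) * e) = e + qInt α (k + 1) • (e * T (a + k) * e) := by
    rw [shuffle, add_mul, one_mul, mul_add, blockSymmetrizer_mul hq hl, ← mul_assoc, ← mul_assoc,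
      mul_shuffle hr, smul_mul_assoc, smul_mul_assoc]
  intro j hj1 hj2
  rw [blockSymmetrizer, ← he, ← h2, h1, mul_smul_comm, hS j hj1 (by omega), smul_comm]

theorem IsHeckeFamily.blockSymmetrizer_absorb (h : IsHeckeFamily α m T) {a k : ℕ}
    (hk : a + k ≤ m) (hq : ∀ i, 0 < i → i ≤ k + 1 → qInt α i ≠ 0) :
    (∀ j, a ≤ j → j < a + k → T j * blockSymmetrizer α T a k = α • blockSymmetrizer α T a k) ∧
    (∀ j, a ≤ j → j < a + k → blockSymmetrizer α T a k * T j = α • blockSymmetrizer α T a k) := by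
  induction k with
  | zero => exact ⟨fun j _ _ => by omega, fun j _ _ => by omega⟩
  | succ k ih =>
    have hq' : ∀ i, 0 < i → i ≤ k + 1 → qInt α i ≠ 0 := fun i h1 h2 => hq i h1 (by omega)
    obtain ⟨hl, hr⟩ := ih (by omega) hq'
    refine ⟨h.mul_blockSymmetrizer_succ_of_absorb (by omega) hq' hl hr, fun j h1 h2 => ?_⟩
    have := h.op.mul_blockSymmetrizer_succ_of_absorb (a := a) (k := k) (by omega) hq'
      (fun j h1 h2 => by
        rw [op_blockSymmetrizer, ← MulOpposite.op_mul, hr j h1 h2, MulOpposite.op_smul])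
      (fun j h1 h2 => by
        rw [op_blockSymmetrizer, ← MulOpposite.op_mul, hl j h1 h2, MulOpposite.op_smul]) j h1 h2
    rw [op_blockSymmetrizer, ← MulOpposite.op_mul, ← MulOpposite.op_smul] at this
    exact MulOpposite.op_injective this

end HeckeFamily

/-! ### Trace functions on Hecke algebras -/

section TraceFunctions

variable {F A : Type*} [Field F] [Ring A] [Algebra F A] {α : F} {m : ℕ} {T : ℕ → A}

variable (F T) in
/-- The parabolic subalgebra generated by `T 0, …, T (k - 1)`. -/
def initialSubalgebra (k : ℕ) : Subalgebra F A := Algebra.adjoin F (T '' Set.Iio k)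

theorem mem_initialSubalgebra {j k : ℕ} (hj : j < k) : T j ∈ initialSubalgebra F T k :=
  Algebra.subset_adjoin ⟨j, hj, rfl⟩

theorem initialSubalgebra_mono {k l : ℕ} (h : k ≤ l) :
    initialSubalgebra F T k ≤ initialSubalgebra F T l :=
  Algebra.adjoin_mono (Set.image_mono (Set.Iio_subset_Iio h))

theorem commute_of_mem_initialSubalgebra {k : ℕ} {x y : A} (hx : ∀ j < k, Commute x (T j))
    (hy : y ∈ initialSubalgebra F T k) : Commute x y := by
  induction hy using Algebra.adjoin_induction with
  | mem y hy => obtain ⟨j, hj, rfl⟩ := hy; exact hx j hj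
  | algebraMap r => exact (Algebra.commutes r x).symm
  | add y z _ _ h1 h2 => exact h1.add_right h2
  | mul y z _ _ h1 h2 => exact h1.mul_right h2

variable (F T) in
/-- The additive group `H_k + H_k T_k H_k`, where `H_k` is generated by `T 0, …, T (k - 1)`. -/
def doubleCosetSpan (k : ℕ) : AddSubmonoid A :=
  AddSubmonoid.closure ({x | x ∈ initialSubalgebra F T k} ∪
    {x | ∃ a ∈ initialSubalgebra F T k, ∃ b ∈ initialSubalgebra F T k, x = a * T k * b})

theorem mem_doubleCosetSpan_of_mem {k : ℕ} {a : A} (ha : a ∈ initialSubalgebra F T k) :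
    a ∈ doubleCosetSpan F T k :=
  AddSubmonoid.subset_closure (Or.inl ha)

theorem mul_mul_mem_doubleCosetSpan {k : ℕ} {a b : A} (ha : a ∈ initialSubalgebra F T k)
    (hb : b ∈ initialSubalgebra F T k) : a * T k * b ∈ doubleCosetSpan F T k :=
  AddSubmonoid.subset_closure (Or.inr ⟨a, ha, b, hb, rfl⟩)

theorem mul_mem_doubleCosetSpan_of_mem {k : ℕ} {c y d : A} (hc : c ∈ initialSubalgebra F T k)
    (hd : d ∈ initialSubalgebra F T k) (hy : y ∈ doubleCosetSpan F T k) :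
    c * y * d ∈ doubleCosetSpan F T k := by
  induction hy using AddSubmonoid.closure_induction with
  | mem y hy =>
    rcases hy with hy | ⟨a, ha, b, hb, rfl⟩
    · exact mem_doubleCosetSpan_of_mem (mul_mem (mul_mem hc hy) hd)
    · rw [show c * (a * T k * b) * d = (c * a) * T k * (b * d) by simp only [mul_assoc]]
      exact mul_mul_mem_doubleCosetSpan (mul_mem hc ha) (mul_mem hb hd)
  | zero => rw [mul_zero, zero_mul]; exact zero_mem _
  | add y z _ _ h1 h2 => rw [mul_add, add_mul]; exact add_mem h1 h2

theorem initialSubalgebra_succ_le_of_sandwich {k : ℕ}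
    (hk : ∀ a ∈ initialSubalgebra F T k, T k * a * T k ∈ doubleCosetSpan F T k) {y : A}
    (hy : y ∈ initialSubalgebra F T (k + 1)) : y ∈ doubleCosetSpan F T k := by
  -- It suffices that the span is stable under left multiplication by the generators.
  suffices ∀ z ∈ doubleCosetSpan F T k, y * z ∈ doubleCosetSpan F T k by
    simpa using this 1 (mem_doubleCosetSpan_of_mem (one_mem _))
  induction hy using Algebra.adjoin_induction with
  | mem y hy =>
    obtain ⟨j, hj, rfl⟩ := hy
    intro z hz
    rcases Nat.lt_succ_iff_lt_or_eq.mp hj with hj | rfl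
    · simpa using mul_mem_doubleCosetSpan_of_mem (mem_initialSubalgebra hj) (one_mem _) hz
    · induction hz using AddSubmonoid.closure_induction with
      | mem z hz =>
        rcases hz with hz | ⟨a, ha, b, hb, rfl⟩
        · simpa using mul_mul_mem_doubleCosetSpan (T := T) (one_mem _) hz
        · rw [show T j * (a * T j * b) = 1 * (T j * a * T j) * b by
            simp only [mul_assoc, one_mul]]
          exact mul_mem_doubleCosetSpan_of_mem (one_mem _) hb (hk a ha)
      | zero => rw [mul_zero]; exact zero_mem _
      | add y z _ _ h1 h2 => rw [mul_add]; exact add_mem h1 h2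
  | algebraMap r =>
    intro z hz
    simpa using mul_mem_doubleCosetSpan_of_mem
      (algebraMap_mem (initialSubalgebra F T k) r) (one_mem _) hz
  | add x y _ _ h1 h2 => intro z hz; rw [add_mul]; exact add_mem (h1 z hz) (h2 z hz)
  | mul x y _ _ h1 h2 => intro z hz; rw [mul_assoc]; exact h1 _ (h2 z hz)

theorem IsHeckeFamily.sandwich_mem (h : IsHeckeFamily α m T) {k : ℕ} (hk : k < m) {a : A}
    (ha : a ∈ initialSubalgebra F T k) : T k * a * T k ∈ doubleCosetSpan F T k := by
  have hsq : ∀ {k : ℕ} {a : A}, k < m → a ∈ initialSubalgebra F T k → Commute (T k) a →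
      T k * a * T k ∈ doubleCosetSpan F T k := by
    intro k a hk ha hc
    rw [hc.eq, mul_assoc, h.quad k hk, mul_add, mul_smul_comm, mul_smul_comm, mul_one,
      ← smul_mul_assoc]
    refine add_mem ?_ (mem_doubleCosetSpan_of_mem (Subalgebra.smul_mem _ ha _))
    simpa using mul_mul_mem_doubleCosetSpan (T := T) (Subalgebra.smul_mem _ ha (α - 1)) (one_mem _)
  induction k generalizing a with
  | zero =>
    exact hsq hk ha (commute_of_mem_initialSubalgebra (fun j hj => absurd hj (by omega)) ha)
  | succ k ih =>
    have hcomm : ∀ c ∈ initialSubalgebra F T k, Commute (T (k + 1)) c := fun c hc =>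
      commute_of_mem_initialSubalgebra
        (fun j hj => h.commute hk (by omega) (Or.inr (by omega))) hc
    have hle := initialSubalgebra_mono (F := F) (T := T) (Nat.le_succ k)
    have := initialSubalgebra_succ_le_of_sandwich (fun a ha => ih (by omega) ha) ha
    clear ha
    induction this using AddSubmonoid.closure_induction with
    | mem z hz =>
      rcases hz with hz | ⟨c, hc, d, hd, rfl⟩
      · exact hsq hk (hle hz) (hcomm z hz)
      · have e : T (k + 1) * (c * T k * d) * T (k + 1) =
            (c * T k) * T (k + 1) * (T k * d) := by
          calc _ = (T (k + 1) * c) * T k * (d * T (k + 1)) := by simp only [mul_assoc]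
            _ = c * (T (k + 1) * T k * T (k + 1)) * d := by
              rw [(hcomm c hc).eq, ← (hcomm d hd).eq]; simp only [mul_assoc]
            _ = _ := by rw [← h.braid k hk]; simp only [mul_assoc]
        rw [e]
        exact mul_mul_mem_doubleCosetSpan
          (mul_mem (hle hc) (mem_initialSubalgebra (Nat.lt_succ_self k)))
          (mul_mem (mem_initialSubalgebra (Nat.lt_succ_self k)) (hle hd))
    | zero => rw [mul_zero, zero_mul]; exact zero_mem _
    | add y z _ _ h1 h2 => rw [mul_add, add_mul]; exact add_mem h1 h2

/-- `H_{k + 1} = H_k + H_k T_k H_k`. -/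
theorem IsHeckeFamily.initialSubalgebra_succ_le (h : IsHeckeFamily α m T) {k : ℕ} (hk : k < m)
    {y : A} (hy : y ∈ initialSubalgebra F T (k + 1)) : y ∈ doubleCosetSpan F T k :=
  initialSubalgebra_succ_le_of_sandwich (fun _ ha => h.sandwich_mem hk ha) hy

variable (m T) in
/-- `IsTail m T k t` says that `t` is a product of some of the generators `T k, …, T (m - 1)`,
each at most once and in increasing order of the indices. -/
inductive IsTail : ℕ → A → Prop
  | one : IsTail m 1
  | skip {k : ℕ} {t : A} : IsTail (k + 1) t → IsTail k t
  | cons {k : ℕ} {t : A} : k < m → IsTail (k + 1) t → IsTail k (T k * t)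

theorem IsTail.commute {k : ℕ} {t x : A} (ht : IsTail m T k t)
    (hx : ∀ j, k ≤ j → j < m → Commute x (T j)) : Commute x t := by
  induction ht with
  | one => exact Commute.one_right x
  | skip _ ih => exact ih fun j h1 h2 => hx j (by omega) h2
  | cons hk _ ih => exact (hx _ le_rfl hk).mul_right (ih fun j h1 h2 => hx j (by omega) h2)

/-- Modulo commutators the Hecke algebra is spanned by the ordered products of distinct
generators. -/
theorem IsHeckeFamily.trace_eq_zero_of_isTail (h : IsHeckeFamily α m T) (f : A →ₗ[F] F)
    (hf : ∀ a b, f (a * b) = f (b * a)) (h0 : ∀ t, IsTail m T 0 t → f t = 0) {k : ℕ}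
    (hk : k ≤ m) : ∀ t, IsTail m T k t → ∀ y ∈ initialSubalgebra F T k, f (y * t) = 0 := by
  induction k with
  | zero =>
    intro t ht y hy
    have : initialSubalgebra F T 0 = ⊥ := by
      rw [initialSubalgebra, show Set.Iio 0 = (∅ : Set ℕ) by ext; simp, Set.image_empty,
        Algebra.adjoin_empty]
    rw [this, Algebra.mem_bot] at hy
    obtain ⟨r, rfl⟩ := hy
    rw [← Algebra.smul_def, map_smul, h0 t ht, smul_zero]
  | succ k ih =>
    intro t ht y hy
    replace hy := h.initialSubalgebra_succ_le hk hy
    induction hy using AddSubmonoid.closure_induction with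
    | mem y hy =>
      rcases hy with hy | ⟨b, hb, c, hc, rfl⟩
      · exact ih (by omega) t ht.skip y hy
      · have hct : Commute c t := ht.commute fun j h1 h2 =>
          (commute_of_mem_initialSubalgebra
            (fun i hi => h.commute h2 (by omega) (Or.inr (by omega))) hc).symm
        rw [mul_assoc, hct.eq, ← mul_assoc, hf, mul_assoc b, ← mul_assoc]
        exact ih (by omega) _ (ht.cons (by omega)) _ (mul_mem hc hb)
    | zero => rw [zero_mul, map_zero]
    | add y z _ _ h1 h2 => rw [add_mul, map_add, h1, h2, add_zero]

theorem map_blockSymmetrizer {B : Type*} [Ring B] [Algebra F B] (φ : A →ₐ[F] B) (a k : ℕ) :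
    φ (blockSymmetrizer α T a k) = blockSymmetrizer α (fun i => φ (T i)) a k := by
  induction k with
  | zero => exact map_one φ
  | succ k ih => simp [blockSymmetrizer, ih]

variable (α m T) in
/-- An idempotent `E` which commutes with `T j` for `j ≥ a`, and which acts from the right by `1`
on every element `w` of a `B`-valued representation such that all generators which `E` absorbs
act on `w` by `α`. These are the properties of the symmetrizer of a parabolic subalgebra
supported on the strands before `a` which the argument uses. -/
structure IsBlockIdempotent (B : Type*) [Ring B] [Algebra F B] (a : ℕ) (E : A) : Prop where
  commute : ∀ j, a ≤ j → j < m → Commute (T j) E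
  idem : E * E = E
  mul_eq : ∀ (φ : A →ₐ[F] B) (w : B),
    (∀ j < m, T j * E = α • E → w * φ (T j) = α • w) → w * φ E = w

section BlockIdempotent

variable {B : Type*} [Ring B] [Algebra F B]

theorem IsBlockIdempotent.one : IsBlockIdempotent α m T B 0 1 where
  commute _ _ _ := Commute.one_right _
  idem := one_mul 1
  mul_eq φ w _ := by rw [map_one, mul_one]

/-- The product of a block idempotent with the symmetrizer of a disjoint block on its right. -/
theorem IsBlockIdempotent.mul_blockSymmetrizer (h : IsHeckeFamily α m T) {a k l : ℕ} {E : A}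
    (hE : IsBlockIdempotent α m T B a E) (hk : a + k ≤ m) (hl : a + k < l)
    (hq : ∀ i, 0 < i → i ≤ k + 1 → qInt α i ≠ 0) :
    IsBlockIdempotent α m T B l (E * blockSymmetrizer α T a k) := by
  set e := blockSymmetrizer α T a k
  have he := (h.blockSymmetrizer_absorb hk hq).1
  have hee : e * e = e := blockSymmetrizer_mul hq he
  have hEe : Commute E e := commute_blockSymmetrizer fun j h1 h2 =>
    (hE.commute j h1 (by omega)).symm
  refine ⟨fun j h1 h2 => (hE.commute j (by omega) h2).mul_right
    (commute_blockSymmetrizer fun i h3 h4 => h.commute h2 (by omega) (Or.inr (by omega))), ?_, ?_⟩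
  · rw [mul_assoc, ← mul_assoc e, ← hEe.eq, mul_assoc E e, hee, ← mul_assoc, hE.idem]
  · intro φ w hw
    have h1 : w * φ E = w := hE.mul_eq φ w fun j hj hjE => hw j hj (by
      rw [← mul_assoc, hjE, smul_mul_assoc])
    rw [map_mul, ← mul_assoc, h1, map_blockSymmetrizer]
    exact _root_.mul_blockSymmetrizer hq fun j h1 h2 => hw j (by omega) (by
      rw [← mul_assoc, (hE.commute j h1 (by omega)).eq, mul_assoc, he j h1 h2, mul_smul_comm])

/-- Applied to a block idempotent times an ordered product of generators, a trace function reduces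
to block idempotents with fewer generators left over: modulo commutators,
`[k + 1] E e_k T_b t = [k + 2] E e_{k + 1} t - E e_k t`. -/
theorem IsHeckeFamily.trace_mul_tail_eq_zero (h : IsHeckeFamily α m T)
    (hq : ∀ i, 0 < i → i ≤ m + 1 → qInt α i ≠ 0) (f : A →ₗ[F] F)
    (hf : ∀ a b, f (a * b) = f (b * a))
    (h0 : ∀ l E, IsBlockIdempotent α m T B l E → f E = 0) {b : ℕ} {t : A}
    (ht : IsTail m T b t) : ∀ a k E, a + k = b → b ≤ m → IsBlockIdempotent α m T B a E →
      f (E * blockSymmetrizer α T a k * t) = 0 := by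
  have hq' : ∀ k, k ≤ m → ∀ i, 0 < i → i ≤ k + 1 → qInt α i ≠ 0 := fun k hk i h1 h2 =>
    hq i h1 (by omega)
  induction ht with
  | one =>
    intro a k E hk _ hE
    rw [mul_one]
    exact h0 (m + 1) _ (hE.mul_blockSymmetrizer h hk.le (by omega) (hq' k (by omega)))
  | @skip b t ht ih =>
    intro a k E hk hb hE
    rcases hb.lt_or_eq with hb | rfl
    · have := ih (b + 1) 0 _ rfl hb
        (hE.mul_blockSymmetrizer h (by omega) (by omega) (hq' k (by omega)))
      rwa [blockSymmetrizer, mul_one] at this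
    · exfalso
      have : ∀ {c : ℕ} {t : A}, IsTail b T c t → c ≤ b := fun ht => by
        induction ht <;> omega
      have := this ht
      omega
  | @cons b t hb ht ih =>
    intro a k E hk _ hE
    set e := blockSymmetrizer α T a k with he
    have hqk := hq' k (by omega)
    have hee : e * e = e := blockSymmetrizer_mul hqk (h.blockSymmetrizer_absorb (by omega) hqk).1
    have hEe : Commute E e := commute_blockSymmetrizer fun j h1 h2 =>
      (hE.commute j h1 (by omega)).symm
    have het : Commute e t := ht.commute fun j h1 h2 =>
      (commute_blockSymmetrizer fun i h3 h4 =>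
        h.commute h2 (by omega) (Or.inr (by omega))).symm
    have h1 : f (E * blockSymmetrizer α T a (k + 1) * t) = 0 := ih a (k + 1) E (by omega) hb hE
    have h2 : f (E * e * t) = 0 := by
      have := ih (b + 1) 0 _ rfl hb
        (hE.mul_blockSymmetrizer h (by omega) (by omega) hqk)
      rwa [blockSymmetrizer, mul_one] at this
    have h3 : f (E * (e * T b * e) * t) = f (E * e * (T b * t)) := by
      calc _ = f (E * e * T b * (e * t)) := by simp only [mul_assoc]
        _ = f ((E * e * T b * t) * e) := by rw [het.eq]; simp only [mul_assoc]
        _ = f ((e * E) * e * (T b * t)) := by rw [hf]; simp only [mul_assoc]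
        _ = _ := by rw [← hEe.eq, mul_assoc E, hee]
    rw [blockSymmetrizer, hk, ← he, mul_smul_comm, smul_mul_assoc, map_smul, smul_eq_mul,
      mul_eq_zero, or_iff_right (inv_ne_zero (hq _ (by omega) (by omega))), mul_add, add_mul,
      map_add, h2, zero_add, mul_smul_comm, smul_mul_assoc, map_smul, smul_eq_mul, mul_eq_zero,
      or_iff_right (hq _ (by omega) (by omega)), h3] at h1
    exact h1

theorem IsHeckeFamily.trace_eq_zero (h : IsHeckeFamily α m T)
    (hq : ∀ i, 0 < i → i ≤ m + 1 → qInt α i ≠ 0) (f : A →ₗ[F] F)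
    (hf : ∀ a b, f (a * b) = f (b * a))
    (h0 : ∀ l E, IsBlockIdempotent α m T B l E → f E = 0) :
    ∀ y ∈ initialSubalgebra F T m, f y = 0 := by
  intro y hy
  have := h.trace_eq_zero_of_isTail f hf (fun t ht => by
    have := h.trace_mul_tail_eq_zero (B := B) hq f hf h0 ht 0 0 1 rfl (Nat.zero_le _)
      IsBlockIdempotent.one
    rwa [blockSymmetrizer, mul_one, one_mul] at this) le_rfl 1 IsTail.one y hy
  rwa [mul_one] at this

end BlockIdempotent

end TraceFunctions

/-! ### The Hecke algebra of the braid group -/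

namespace HeckeAlgebra

variable {F : Type*} [Field F] {n : ℕ} {α : Fˣ}

theorem ofBraid_apply (g : BraidGroup n) : ofBraid F n α g =
    RingQuot.mkAlgHom F (HeckeRel F n α) (MonoidAlgebra.of F (BraidGroup n) g) := rfl

variable (F n α) in
/-- The image of the Artin generator `σ_i` in the Hecke algebra, extended by `0` to all `i : ℕ`. -/
noncomputable def gen (i : ℕ) : HeckeAlgebra F n α :=
  if h : i < n - 1 then ofBraid F n α (BraidGroup.σ ⟨i, h⟩) else 0

theorem gen_of_lt {i : ℕ} (h : i < n - 1) :
    gen F n α i = ofBraid F n α (BraidGroup.σ ⟨i, h⟩) := dif_pos h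

theorem braid_relation (i j : Fin (n - 1)) (h : (i : ℕ) + 1 = j) :
    (BraidGroup.σ i * BraidGroup.σ j * BraidGroup.σ i : BraidGroup n) =
      BraidGroup.σ j * BraidGroup.σ i * BraidGroup.σ j :=
  PresentedGroup.mk_eq_mk_of_mul_inv_mem (BraidRelator.braid i j h)

theorem comm_relation (i j : Fin (n - 1)) (h : (i : ℕ) + 2 ≤ j) :
    (BraidGroup.σ i * BraidGroup.σ j : BraidGroup n) = BraidGroup.σ j * BraidGroup.σ i :=
  PresentedGroup.mk_eq_mk_of_mul_inv_mem (BraidRelator.comm i j h)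

theorem quad_relation (i : Fin (n - 1)) :
    (ofBraid F n α (BraidGroup.σ i) + 1) *
      (ofBraid F n α (BraidGroup.σ i) - algebraMap F _ (α : F)) = 0 := by
  have := RingQuot.mkAlgHom_rel F (HeckeRel.quadratic (F := F) (n := n) (α := α) i)
  rwa [map_mul, map_add, map_sub, map_one, map_zero, AlgHom.commutes] at this

/-- The two usual forms of the quadratic relation. -/
theorem quadratic_iff {A : Type*} [Ring A] [Algebra F A] (a : F) (t : A) :
    (t + 1) * (t - algebraMap F A a) = 0 ↔ t * t = (a - 1) • t + a • 1 := by
  have : (t + 1) * (t - algebraMap F A a) = t * t - ((a - 1) • t + a • 1) := by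
    rw [Algebra.algebraMap_eq_smul_one, add_mul, mul_sub, one_mul, mul_smul_comm, mul_one,
      sub_smul, one_smul]
    abel
  rw [this, sub_eq_zero]

theorem isHeckeFamily_gen : IsHeckeFamily (α : F) (n - 1) (gen F n α) where
  quad i hi := by
    rw [gen_of_lt hi]
    exact (quadratic_iff _ _).mp (quad_relation _)
  braid i hi := by
    rw [gen_of_lt hi, gen_of_lt (Nat.lt_of_succ_lt hi)]
    simp only [← map_mul]
    rw [braid_relation _ _ rfl]
  comm i j hij hj := by
    rw [gen_of_lt hj, gen_of_lt (show i < n - 1 by omega), ← map_mul, ← map_mul,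
      comm_relation _ _ hij]

/-- A representation of the braid group whose generators satisfy the quadratic relation factors
through the Hecke algebra. -/
theorem exists_algHom_of_monoidHom {A : Type*} [Ring A] [Algebra F A] (R : BraidGroup n →* A)
    (hR : ∀ i, (R (BraidGroup.σ i) + 1) * (R (BraidGroup.σ i) - algebraMap F A (α : F)) = 0) :
    ∃ ρ : HeckeAlgebra F n α →ₐ[F] A, ∀ g, ρ (ofBraid F n α g) = R g := by
  refine ⟨RingQuot.liftAlgHom F ⟨MonoidAlgebra.lift F A _ R, ?_⟩, fun g => ?_⟩
  · rintro _ _ ⟨i⟩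
    simpa [Algebra.algebraMap_eq_smul_one] using hR i
  · rw [ofBraid_apply, RingQuot.liftAlgHom_mkAlgHom_apply]
    simp

theorem exists_algHom_of_isHeckeFamily {A : Type*} [Ring A] [Algebra F A] {T : ℕ → A}
    (h : IsHeckeFamily (α : F) (n - 1) T) :
    ∃ ρ : HeckeAlgebra F n α →ₐ[F] A, ∀ i < n - 1, ρ (gen F n α i) = T i := by
  -- The quadratic relation makes `T i` invertible, with inverse `α⁻¹ (T i + 1 - α)`.
  have hu : ∀ i : Fin (n - 1), ∃ u : Aˣ, (u : A) = T i := fun i => by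
    have hq := h.quad i i.2
    have e : T i * T i + T i - (α : F) • T i = (α : F) • 1 := by
      rw [hq, sub_smul, one_smul]; abel
    refine ⟨⟨T i, (α : F)⁻¹ • (T i + 1 - (α : F) • 1), ?_, ?_⟩, rfl⟩
    · rw [mul_smul_comm, mul_sub, mul_add, mul_one, mul_smul_comm, mul_one, e, smul_smul,
        inv_mul_cancel₀ α.ne_zero, one_smul]
    · rw [smul_mul_assoc, sub_mul, add_mul, one_mul, smul_mul_assoc, one_mul, e, smul_smul,
        inv_mul_cancel₀ α.ne_zero, one_smul]
  choose u hu using hu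
  have hrel : ∀ r ∈ {r | BraidRelator n r}, FreeGroup.lift u r = 1 := by
    rintro _ (⟨i, j, hij⟩ | ⟨i, j, hij⟩)
    · simp only [map_mul, map_inv, FreeGroup.lift_apply_of, mul_inv_eq_one]
      ext
      have := h.braid i (by omega)
      simp only [Units.val_mul, hu]
      rwa [hij] at this
    · simp only [map_mul, map_inv, FreeGroup.lift_apply_of, mul_inv_eq_one]
      ext
      simp only [Units.val_mul, hu]
      exact h.comm i j hij j.2
  have hσ : ∀ i, ((PresentedGroup.toGroup hrel (BraidGroup.σ i) : Aˣ) : A) = T i := fun i => by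
    rw [BraidGroup.σ, PresentedGroup.toGroup.of, hu]
  obtain ⟨ρ, hρ⟩ := exists_algHom_of_monoidHom (α := α)
    ((Units.coeHom A).comp (PresentedGroup.toGroup hrel)) (fun i => by
      rw [MonoidHom.comp_apply, Units.coeHom_apply, hσ, quadratic_iff]
      exact h.quad i i.2)
  refine ⟨ρ, fun i hi => ?_⟩
  rw [gen_of_lt hi, hρ, MonoidHom.comp_apply, Units.coeHom_apply, hσ]

/-- The Hecke algebra is generated by the images of the Artin generators; their inverses are not
needed because of the quadratic relation. -/
theorem initialSubalgebra_gen : initialSubalgebra F (gen F n α) (n - 1) = ⊤ := by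
  set S := initialSubalgebra F (gen F n α) (n - 1)
  have hgen : ∀ g : BraidGroup n, ofBraid F n α g ∈ S := by
    intro g
    have hg : g ∈ Subgroup.closure (Set.range (BraidGroup.σ : Fin (n - 1) → BraidGroup n)) := by
      have : Subgroup.closure (Set.range (BraidGroup.σ : Fin (n - 1) → BraidGroup n)) = ⊤ :=
        PresentedGroup.closure_range_of _
      rw [this]; trivial
    have hmem : ∀ i : Fin (n - 1), ofBraid F n α (BraidGroup.σ i) ∈ S := fun i => by
      rw [← gen_of_lt i.2]; exact mem_initialSubalgebra i.2
    induction hg using Subgroup.closure_induction'' with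
    | mem x hx => obtain ⟨i, rfl⟩ := hx; exact hmem i
    | inv_mem x hx =>
      obtain ⟨i, rfl⟩ := hx
      set t := ofBraid F n α (BraidGroup.σ i) with ht
      have hq := (quadratic_iff (α : F) t).mp (quad_relation i)
      have h1 : ofBraid F n α (BraidGroup.σ i)⁻¹ * t = 1 := by
        rw [ht, ← map_mul, inv_mul_cancel, map_one]
      have h2 : ofBraid F n α (BraidGroup.σ i)⁻¹ = (α : F)⁻¹ • (t - ((α : F) - 1) • 1) := by
        have := congrArg (ofBraid F n α (BraidGroup.σ i)⁻¹ * ·) hq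
        simp only [← mul_assoc, h1, one_mul, mul_add, mul_smul_comm, mul_one] at this
        rw [this, add_sub_cancel_left, smul_smul, inv_mul_cancel₀ α.ne_zero, one_smul]
      rw [h2]
      exact S.smul_mem (S.sub_mem (hmem i) (S.smul_mem S.one_mem _)) _
    | one => rw [map_one]; exact S.one_mem
    | mul x y _ _ hx hy => rw [map_mul]; exact S.mul_mem hx hy
  rw [eq_top_iff]
  rintro y -
  obtain ⟨z, rfl⟩ := RingQuot.mkAlgHom_surjective F (HeckeRel F n α) y
  induction z using MonoidAlgebra.induction_on with
  | of g => exact hgen g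
  | add x y hx hy => rw [map_add]; exact S.add_mem hx hy
  | smul r x hx => rw [map_smul]; exact S.smul_mem hx r

end HeckeAlgebra

/-! ### Semisimplicity and quantum integers -/

section Symmetrizer

variable {F A : Type*} [Field F] [Ring A] [Algebra F A] {α : F} {m : ℕ} {T : ℕ → A}

/-- The symmetrizer `∑ T_w` of the subalgebra generated by `T 0, …, T (k - 1)`. -/
def symmetrizer (T : ℕ → A) : ℕ → A
  | 0 => 1
  | k + 1 => shuffle T 0 (k + 1) * symmetrizer T k

theorem mul_symmetrizer (h : IsHeckeFamily α m T) {k : ℕ} (hk : k ≤ m) :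
    ∀ j < k, T j * symmetrizer T k = α • symmetrizer T k := by
  induction k with
  | zero => exact fun j hj => absurd hj (Nat.not_lt_zero j)
  | succ k ih =>
    intro j hj
    exact mul_shuffle_mul h 0 k (by omega) _ (fun i _ hi => ih (by omega) i (by omega)) j
      (Nat.zero_le _) (by omega)

theorem shuffle_mul {w : A} {k : ℕ} (hw : ∀ j < k, T j * w = α • w) :
    shuffle T 0 k * w = qInt α (k + 1) • w := by
  induction k with
  | zero => simp [shuffle, qInt_one]
  | succ k ih =>
    rw [shuffle, add_mul, one_mul, mul_assoc, zero_add, hw k (by omega), mul_smul_comm,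
      ih fun j h1 => hw j (by omega), qInt_succ (k + 1), add_smul, one_smul, smul_smul]

theorem symmetrizer_mul {w : A} {k : ℕ} (hw : ∀ j < k, T j * w = α • w) :
    symmetrizer T k * w = (∏ i ∈ Finset.range k, qInt α (i + 2)) • w := by
  induction k with
  | zero => simp [symmetrizer]
  | succ k ih =>
    rw [symmetrizer, mul_assoc, ih fun j h1 => hw j (by omega), mul_smul_comm, shuffle_mul hw,
      smul_smul, Finset.prod_range_succ]

theorem map_shuffle {B : Type*} [Ring B] [Algebra F B] (φ : A →ₐ[F] B) (k : ℕ) :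
    φ (shuffle T 0 k) = shuffle (fun i => φ (T i)) 0 k := by
  induction k with
  | zero => exact map_one φ
  | succ k ih => simp [shuffle, ih]

theorem map_symmetrizer {B : Type*} [Ring B] [Algebra F B] (φ : A →ₐ[F] B) (k : ℕ) :
    φ (symmetrizer T k) = symmetrizer (fun i => φ (T i)) k := by
  induction k with
  | zero => exact map_one φ
  | succ k ih => simp only [symmetrizer, map_mul, ih, map_shuffle]

end Symmetrizer

section RegularRepresentation

variable {F : Type*} [Field F]

/-- The action of a generator of the Hecke algebra on functions on the permutations of `ℕ`,
modelled on the regular representation. -/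
def permOp (α : F) (i : ℕ) : Module.End F (Equiv.Perm ℕ → F) where
  toFun f w := if w i < w (i + 1) then f (w * Equiv.swap i (i + 1))
    else α * f (w * Equiv.swap i (i + 1)) + (α - 1) * f w
  map_add' f g := by ext w; simp only [Pi.add_apply]; split_ifs <;> ring
  map_smul' c f := by
    ext w; simp only [Pi.smul_apply, smul_eq_mul, RingHom.id_apply]; split_ifs <;> ring

theorem permOp_apply (α : F) (i : ℕ) (f : Equiv.Perm ℕ → F) (w : Equiv.Perm ℕ) :
    permOp α i f w = if w i < w (i + 1) then f (w * Equiv.swap i (i + 1))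
      else α * f (w * Equiv.swap i (i + 1)) + (α - 1) * f w := rfl

theorem isHeckeFamily_permOp (α : F) (m : ℕ) : IsHeckeFamily α m (permOp α) where
  quad i _ := by
    ext f w
    have hne : w i ≠ w (i + 1) := fun h => by simpa using w.injective h
    simp only [Module.End.mul_apply, permOp_apply, LinearMap.add_apply, LinearMap.smul_apply,
      Module.End.one_apply, Pi.add_apply, Pi.smul_apply, smul_eq_mul, Equiv.Perm.mul_apply,
      Equiv.swap_apply_left, Equiv.swap_apply_right, mul_assoc, Equiv.swap_mul_self, mul_one]
    rcases hne.lt_or_gt with h | h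
    · simp only [h, h.not_gt, if_true, if_false]; ring
    · simp only [h, h.not_gt, if_true, if_false]; ring
  braid i _ := by
    ext f w
    have h1 : w i ≠ w (i + 1) := fun h => by simpa using w.injective h
    have h2 : w (i + 1) ≠ w (i + 2) := fun h => by simpa using w.injective h
    have h3 : w i ≠ w (i + 2) := fun h => by simpa using w.injective h
    have e1 : Equiv.swap i (i + 1) (i + 2) = i + 2 :=
      Equiv.swap_apply_of_ne_of_ne (by omega) (by omega)
    have e2 : Equiv.swap (i + 1) (i + 2) i = i :=
      Equiv.swap_apply_of_ne_of_ne (by omega) (by omega)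
    have hb : Equiv.swap i (i + 1) * (Equiv.swap (i + 1) (i + 2) * Equiv.swap i (i + 1)) =
        Equiv.swap (i + 1) (i + 2) * (Equiv.swap i (i + 1) * Equiv.swap (i + 1) (i + 2)) := by
      rw [← mul_assoc, ← mul_assoc, Equiv.swap_mul_swap_mul_swap, Equiv.swap_comm i (i + 1),
        Equiv.swap_comm (i + 1) (i + 2), Equiv.swap_mul_swap_mul_swap, Equiv.swap_comm]
      all_goals omega
    simp only [Module.End.mul_apply, permOp_apply, Equiv.Perm.mul_apply,
      Equiv.swap_apply_left, Equiv.swap_apply_right, mul_assoc, Equiv.swap_mul_self, mul_one,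
      e1, e2, add_assoc, Nat.reduceAdd, hb]
    rcases h1.lt_or_gt with h1 | h1 <;> rcases h2.lt_or_gt with h2 | h2 <;>
      rcases h3.lt_or_gt with h3 | h3 <;>
      first
      | omega
      | (simp only [h1, h2, h3, h1.not_gt, h2.not_gt, h3.not_gt, if_true, if_false] <;> ring)
  comm i j hij _ := by
    ext f w
    have e1 : Equiv.swap i (i + 1) j = j := Equiv.swap_apply_of_ne_of_ne (by omega) (by omega)
    have e2 : Equiv.swap i (i + 1) (j + 1) = j + 1 :=
      Equiv.swap_apply_of_ne_of_ne (by omega) (by omega)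
    have e3 : Equiv.swap j (j + 1) i = i := Equiv.swap_apply_of_ne_of_ne (by omega) (by omega)
    have e4 : Equiv.swap j (j + 1) (i + 1) = i + 1 :=
      Equiv.swap_apply_of_ne_of_ne (by omega) (by omega)
    have hc : Equiv.swap i (i + 1) * Equiv.swap j (j + 1) =
        Equiv.swap j (j + 1) * Equiv.swap i (i + 1) := by
      apply Equiv.Perm.Disjoint.commute
      intro x
      by_cases hx : x = i ∨ x = i + 1
      · right; rcases hx with rfl | rfl <;> assumption
      · left; exact Equiv.swap_apply_of_ne_of_ne (by tauto) (by tauto)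
    simp only [Module.End.mul_apply, permOp_apply, Equiv.Perm.mul_apply, mul_assoc,
      e1, e2, e3, e4, hc]
    split_ifs <;> ring

/-- The functions vanishing on a set of permutations which is stable under the transpositions
`0, …, k - 1` are stable under the corresponding generators. -/
theorem shuffle_permOp_vanish (α : F) {k : ℕ} {D : Set (Equiv.Perm ℕ)}
    (hD : ∀ j < k, ∀ w ∈ D, w * Equiv.swap j (j + 1) ∈ D) (f : Equiv.Perm ℕ → F)
    (hf : ∀ w ∈ D, f w = 0) : ∀ w ∈ D, shuffle (permOp α) 0 k f w = 0 := by
  induction k generalizing f with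
  | zero => simpa [shuffle] using hf
  | succ k ih =>
    intro w hw
    rw [shuffle, LinearMap.add_apply, Module.End.one_apply, Module.End.mul_apply, Pi.add_apply,
      hf w hw, zero_add]
    refine ih (fun j hj => hD j (by omega)) _ (fun w hw => ?_) w hw
    rw [zero_add, permOp_apply, hf w hw, hf _ (hD k (by omega) w hw)]
    simp

theorem symmetrizer_permOp_vanish (α : F) {k : ℕ} {D : Set (Equiv.Perm ℕ)}
    (hD : ∀ j < k, ∀ w ∈ D, w * Equiv.swap j (j + 1) ∈ D) (f : Equiv.Perm ℕ → F)
    (hf : ∀ w ∈ D, f w = 0) : ∀ w ∈ D, symmetrizer (permOp α) k f w = 0 := by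
  induction k with
  | zero => simpa [symmetrizer] using hf
  | succ k ih =>
    rw [symmetrizer, Module.End.mul_apply]
    exact shuffle_permOp_vanish α hD _ (ih fun j hj => hD j (by omega))

open Classical in
/-- The coefficient of `1` in the symmetrizer is `1`. -/
theorem symmetrizer_permOp_apply_one (α : F) (k : ℕ) :
    symmetrizer (permOp α) k (Pi.single 1 1) 1 = 1 := by
  induction k with
  | zero => simp [symmetrizer]
  | succ k ih =>
    set g := symmetrizer (permOp α) k (Pi.single 1 1) with hg
    -- `g` is supported on permutations fixing `k + 1`.
    have hg0 : ∀ w : Equiv.Perm ℕ, w (k + 1) ≠ k + 1 → g w = 0 := by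
      refine symmetrizer_permOp_vanish α (D := {w | w (k + 1) ≠ k + 1}) ?_ _ ?_
      · intro j hj w hw
        rwa [Set.mem_ofPred_eq, Equiv.Perm.mul_apply,
          Equiv.swap_apply_of_ne_of_ne (by omega) (by omega)]
      · intro w hw
        refine Pi.single_eq_of_ne ?_ _
        rintro rfl
        exact hw rfl
    -- Applying the last generator moves that support off the permutations of `0, …, k`.
    have h1 : ∀ w ∈ {w : Equiv.Perm ℕ | w (k + 1) = k + 1 ∧ ∀ j ≤ k, w j ≤ k},
        shuffle (permOp α) 0 k (permOp α k g) w = 0 := by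
      refine shuffle_permOp_vanish α ?_ _ ?_
      · rintro j hj w ⟨hw1, hw2⟩
        refine ⟨?_, fun i hi => ?_⟩
        · rwa [Equiv.Perm.mul_apply, Equiv.swap_apply_of_ne_of_ne (by omega) (by omega)]
        · rw [Equiv.Perm.mul_apply]
          apply hw2
          rw [Equiv.swap_apply_def]
          split_ifs <;> omega
      · rintro w ⟨hw1, hw2⟩
        have := hw2 k le_rfl
        rw [permOp_apply, if_pos (by omega)]
        apply hg0
        rw [Equiv.Perm.mul_apply, Equiv.swap_apply_right]
        omega
    rw [symmetrizer, Module.End.mul_apply, ← hg, shuffle, LinearMap.add_apply,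
      Module.End.one_apply, Module.End.mul_apply, Pi.add_apply, ih, zero_add,
      h1 1 ⟨rfl, fun j hj => hj⟩, add_zero]

end RegularRepresentation

/-- If some `[i]` with `i ≤ n` vanished, the symmetrizer would span a nilpotent left ideal. -/
theorem HeckeAlgebra.qInt_ne_zero {F : Type*} [Field F] {n : ℕ} {α : Fˣ}
    (hss : IsSemisimpleRing (HeckeAlgebra F n α)) {i : ℕ} (hi : 0 < i) (hin : i ≤ n - 1 + 1) :
    qInt (α : F) i ≠ 0 := by
  intro h0
  rcases Nat.lt_or_ge i 2 with h2 | h2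
  · obtain rfl : i = 1 := by omega
    simp [qInt_one] at h0
  set x := symmetrizer (gen F n α) (n - 1) with hx
  have hTx := mul_symmetrizer (isHeckeFamily_gen (F := F) (n := n) (α := α)) le_rfl
  have hxx : x * x = 0 := by
    rw [hx, symmetrizer_mul hTx, Finset.prod_eq_zero (i := i - 2)
      (Finset.mem_range.mpr (by omega)) (by rwa [Nat.sub_add_cancel h2]), zero_smul]
  have hsmul : ∀ y : HeckeAlgebra F n α, ∃ c : F, y * x = c • x := by
    intro y
    have hy : y ∈ initialSubalgebra F (gen F n α) (n - 1) := by
      rw [initialSubalgebra_gen]; trivial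
    induction hy using Algebra.adjoin_induction with
    | mem y hy => obtain ⟨j, hj, rfl⟩ := hy; exact ⟨α, hTx j hj⟩
    | algebraMap r => exact ⟨r, (Algebra.smul_def r x).symm⟩
    | add y z _ _ h1 h2 =>
      obtain ⟨c, hc⟩ := h1
      obtain ⟨d, hd⟩ := h2
      exact ⟨c + d, by rw [add_mul, hc, hd, add_smul]⟩
    | mul y z _ _ h1 h2 =>
      obtain ⟨c, hc⟩ := h1
      obtain ⟨d, hd⟩ := h2
      exact ⟨d * c, by rw [mul_assoc, hd, mul_smul_comm, hc, smul_smul]⟩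
  have hx0 : x = 0 := by
    obtain ⟨e, he, hspan⟩ := IsSemisimpleRing.ideal_eq_span_idempotent (Ideal.span {x})
    obtain ⟨y, hy⟩ := Ideal.mem_span_singleton'.mp
      (hspan.symm ▸ Ideal.mem_span_singleton_self e : e ∈ Ideal.span {x})
    obtain ⟨c, hc⟩ := hsmul y
    have he0 : e = 0 := by
      rw [← he.eq, ← hy, hc, smul_mul_assoc, mul_smul_comm, hxx, smul_zero, smul_zero]
    rw [he0, Ideal.span_singleton_eq_bot.mpr rfl, Ideal.span_singleton_eq_bot] at hspan
    exact hspan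
  obtain ⟨ρ, hρ⟩ := exists_algHom_of_isHeckeFamily (n := n) (isHeckeFamily_permOp (α : F) (n - 1))
  classical
  have h1 := symmetrizer_permOp_apply_one (α : F) (n - 1)
  have hS : ∀ k ≤ n - 1, shuffle (fun i => ρ (gen F n α i)) 0 k = shuffle (permOp (α : F)) 0 k := by
    intro k hk
    induction k with
    | zero => rfl
    | succ k ih => rw [shuffle, shuffle, ih (by omega), zero_add, hρ k (by omega)]
  have hX : ∀ k ≤ n - 1, symmetrizer (fun i => ρ (gen F n α i)) k =
      symmetrizer (permOp (α : F)) k := by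
    intro k hk
    induction k with
    | zero => rfl
    | succ k ih => rw [symmetrizer, symmetrizer, ih (by omega), hS _ hk]
  rw [← hX _ le_rfl, ← map_symmetrizer, ← hx, hx0, map_zero] at h1
  simp at h1

/-! ### The involution of the finite field -/

/-- A ring endomorphism which behaves like the nontrivial automorphism of a quadratic extension of
finite fields: it is a nontrivial involution, and every fixed element is a norm `ε x * x`. -/
structure IsQuadraticInvolution {F : Type*} [Field F] (ε : F →+* F) : Prop where
  invol : ∀ x, ε (ε x) = x
  nontriv : ∃ x, ε x ≠ x
  exists_norm : ∀ c, ε c = c → ∃ x, ε x * x = c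

theorem isQuadraticInvolution_iterateFrobenius {p : ℕ} [Fact p.Prime] {F : Type*} [Field F]
    [Finite F] [CharP F p] {f : ℕ} (hF : Nat.card F = (p ^ f) ^ 2) :
    IsQuadraticInvolution (iterateFrobenius F p f) := by
  classical
  have : Fintype F := Fintype.ofFinite F
  have hF' : Fintype.card F = (p ^ f) ^ 2 := by rw [← Nat.card_eq_fintype_card, hF]
  set q := p ^ f with hq
  have hq1 : 1 < q := by
    have : 1 < q ^ 2 := hF' ▸ Fintype.one_lt_card
    by_contra! h
    nlinarith [Nat.zero_le q]
  obtain ⟨g, hg⟩ := IsCyclic.exists_generator (α := Fˣ)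
  have hord : orderOf g = (q - 1) * (q + 1) := by
    rw [orderOf_eq_card_of_forall_mem_zpowers hg, Nat.card_eq_fintype_card, Fintype.card_units, hF']
    rw [mul_comm, ← Nat.sq_sub_sq, one_pow]
  refine ⟨fun x => ?_, ?_, fun c hc => ?_⟩
  · rw [iterateFrobenius_def, iterateFrobenius_def, ← pow_mul, ← hq, ← sq, ← hF',
      FiniteField.pow_card]
  · by_contra! h
    have h1 : g ^ (q - 1) = 1 := by
      have := h g
      rw [iterateFrobenius_def, ← hq] at this
      ext
      have h2 : (g : F) ^ (q - 1) * g = 1 * g := by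
        rw [← pow_succ, Nat.sub_add_cancel hq1.le, this, one_mul]
      simpa using mul_right_cancel₀ g.ne_zero h2
    have := Nat.le_of_dvd (by omega) (orderOf_dvd_of_pow_eq_one h1)
    rw [hord] at this
    nlinarith [Nat.sub_pos_of_lt hq1]
  · rcases eq_or_ne c 0 with rfl | h0
    · exact ⟨0, by simp⟩
    -- Write `c = g ^ k`; as `c ^ (q - 1) = 1`, the exponent `k` is divisible by `q + 1`.
    obtain ⟨k, hk⟩ := (isOfFinOrder_of_finite g).mem_zpowers_iff_mem_range_orderOf.mp
      (hg (Units.mk0 c h0)) |> Finset.mem_image.mp |> fun ⟨k, _, hk⟩ => (⟨k, hk⟩ : ∃ k, g ^ k = _)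
    have h1 : g ^ (k * (q - 1)) = 1 := by
      rw [pow_mul, hk]
      ext
      rw [iterateFrobenius_def, ← hq] at hc
      have h2 : c ^ (q - 1) * c = 1 * c := by
        rw [← pow_succ, Nat.sub_add_cancel hq1.le, hc, one_mul]
      simpa using mul_right_cancel₀ h0 h2
    have h2 := orderOf_dvd_of_pow_eq_one h1
    rw [hord, mul_comm k] at h2
    obtain ⟨l, rfl⟩ := Nat.dvd_of_mul_dvd_mul_left (by omega) h2
    refine ⟨((g ^ l : Fˣ) : F), ?_⟩
    rw [iterateFrobenius_def, ← hq, ← pow_succ, ← Units.val_pow_eq_pow_val, ← pow_mul, mul_comm l,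
      hk, Units.val_mk0]

/-- `F` is a quadratic extension of `F_p(α + α⁻¹)`, whose nontrivial automorphism exchanges the two
roots `α` and `α⁻¹` of `X ^ 2 - (α + α⁻¹) X + 1`. -/
theorem exists_iterateFrobenius_eq_inv {p : ℕ} [Fact p.Prime] {F : Type*} [Field F] [Finite F]
    [CharP F p] [Algebra (ZMod p) F] (α : Fˣ)
    (hgen : IntermediateField.adjoin (ZMod p) {(α : F)} = ⊤)
    (hne : IntermediateField.adjoin (ZMod p) {(α : F) + (α : F)⁻¹} ≠
      IntermediateField.adjoin (ZMod p) {(α : F)}) :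
    ∃ f : ℕ, Nat.card F = (p ^ f) ^ 2 ∧ iterateFrobenius F p f α = (α : F)⁻¹ := by
  set a : F := (α : F) with ha
  have ha0 : a ≠ 0 := α.ne_zero
  set K := IntermediateField.adjoin (ZMod p) {a + a⁻¹} with hK
  have hβ : a + a⁻¹ ∈ K := IntermediateField.mem_adjoin_simple_self _ _
  have hKtop : IntermediateField.adjoin K {a} = ⊤ := by
    rw [eq_top_iff]
    rintro x -
    have hx : x ∈ IntermediateField.adjoin (ZMod p) {a} := by rw [hgen]; trivial
    have : IntermediateField.adjoin (ZMod p) {a} ≤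
        (IntermediateField.adjoin K {a}).restrictScalars (ZMod p) := by
      rw [IntermediateField.adjoin_simple_le_iff]
      exact IntermediateField.mem_adjoin_simple_self K a
    exact this hx
  have hint : IsIntegral K a := Algebra.IsIntegral.isIntegral a
  open Polynomial in
  have hdeg : Module.finrank K F ≤ 2 := by
    have h1 := IntermediateField.adjoin.finrank hint
    rw [hKtop, IntermediateField.finrank_top'] at h1
    rw [h1]
    set P : K[X] := X ^ 2 + C (-⟨a + a⁻¹, hβ⟩) * X + C 1 with hP
    have hdP : P.natDegree ≤ 2 := by rw [hP]; compute_degree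
    have hPm : P.Monic := by rw [hP]; monicity!
    refine (Polynomial.natDegree_le_of_dvd (minpoly.dvd K a ?_) hPm.ne_zero).trans hdP
    simp only [hP, map_add, map_mul, map_pow, aeval_X, aeval_C, map_neg, map_one]
    change a ^ 2 + -(a + a⁻¹) * a + 1 = 0
    field_simp
    ring
  have hdeg1 : Module.finrank K F ≠ 1 := by
    intro h
    apply hne
    rw [hgen, eq_top_iff]
    rintro x -
    obtain ⟨c, hc⟩ := (finrank_eq_one_iff_of_nonzero' (1 : F) one_ne_zero).mp h x
    rw [← hc, Algebra.smul_def, mul_one]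
    exact c.2
  have hdeg2 : Module.finrank K F = 2 := by
    have := Module.finrank_pos (R := K) (M := F)
    omega
  have hcardF : Nat.card F = Nat.card K ^ 2 := by
    rw [Module.natCard_eq_pow_finrank (K := K), hdeg2]
  obtain ⟨f, hf⟩ : ∃ f, Nat.card K = p ^ f := ⟨_, by
    rw [Module.natCard_eq_pow_finrank (K := ZMod p), Nat.card_zmod]⟩
  rw [hf] at hcardF
  refine ⟨f, hcardF, ?_⟩
  set ε := iterateFrobenius F p f with hε
  have hfix : ε (a + a⁻¹) = a + a⁻¹ := by
    have : Fintype K := Fintype.ofFinite K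
    have h := FiniteField.pow_card (⟨a + a⁻¹, hβ⟩ : K)
    rw [← Nat.card_eq_fintype_card, hf] at h
    rw [hε, iterateFrobenius_def]
    exact congrArg Subtype.val h
  have hroot : (ε a - a) * (ε a - a⁻¹) = 0 := by
    have h0 : ε a ≠ 0 := (map_ne_zero ε).mpr ha0
    rw [map_add, map_inv₀] at hfix
    have h2 : ε a * (ε a + (ε a)⁻¹) = ε a * (a + a⁻¹) := by rw [hfix]
    rw [mul_add, mul_inv_cancel₀ h0] at h2
    have h3 : a * a⁻¹ = 1 := mul_inv_cancel₀ ha0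
    linear_combination h2 + h3
  rcases mul_eq_zero.mp hroot with h | h
  · exfalso
    obtain ⟨x, hx⟩ := (isQuadraticInvolution_iterateFrobenius hcardF).nontriv
    apply hx
    have hmem : x ∈ IntermediateField.adjoin (ZMod p) {a} := by rw [hgen]; trivial
    clear hx
    induction hmem using IntermediateField.adjoin_induction with
    | mem x hx => rw [Set.mem_singleton_iff.mp hx]; exact sub_eq_zero.mp h
    | algebraMap r =>
      have : ε.comp (algebraMap (ZMod p) F) = algebraMap (ZMod p) F := Subsingleton.elim _ _
      exact congrArg (fun g : ZMod p →+* F => g r) this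
    | add x y _ _ hx hy => rw [map_add, hx, hy]
    | inv x _ hx => rw [map_inv₀, hx]
    | mul x y _ _ hx hy => rw [map_mul, hx, hy]
  · exact sub_eq_zero.mp h

/-! ### Hermitian forms over finite fields -/

section HermitianForm

variable {F : Type*} [Field F] {ε : F →+* F}

theorem exists_self_ne_zero {V : Type*} [AddCommGroup V] [Module F V]
    (hε : IsQuadraticInvolution ε) (B : V →ₛₗ[ε] V →ₗ[F] F)
    {W : Submodule F V} {u w : V} (hu : u ∈ W) (hw : w ∈ W) (huw : B u w ≠ 0) :
    ∃ x ∈ W, B x x ≠ 0 := by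
  by_contra! h
  obtain ⟨c, hc⟩ := hε.nontriv
  have hsum : ∀ y ∈ W, B u y + B y u = 0 := fun y hy => by
    have := h (u + y) (W.add_mem hu hy)
    simpa [h u hu, h y hy] using this
  have h1 := hsum w hw
  have h2 := hsum (c • w) (W.smul_mem c hw)
  simp only [map_smul, map_smulₛₗ, LinearMap.smul_apply, smul_eq_mul] at h2
  have h3 : (ε c - c) * B u w = 0 := by linear_combination ε c * h1 - h2
  exact (mul_ne_zero (sub_ne_zero.mpr hc) huw) h3

/-- Gram-Schmidt: a nondegenerate hermitian form over a finite field has orthonormal families of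
every length up to the dimension. -/
theorem exists_orthonormal {V : Type*} [AddCommGroup V] [Module F V] [FiniteDimensional F V]
    (hε : IsQuadraticInvolution ε) (B : V →ₛₗ[ε] V →ₗ[F] F) (hB : ∀ x y, ε (B x y) = B y x)
    (hnd : ∀ w ≠ 0, ∃ u, B u w ≠ 0) (m : ℕ) (hm : m ≤ Module.finrank F V) :
    ∃ v : Fin m → V, ∀ i j, B (v i) (v j) = if i = j then 1 else 0 := by
  induction m with
  | zero => exact ⟨Fin.elim0, fun i => i.elim0⟩
  | succ m ih =>
    obtain ⟨v, hv⟩ := ih (by omega)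
    set L : V →ₗ[F] (Fin m → F) := LinearMap.pi fun i => B (v i) with hL
    have hLmem : ∀ x, x ∈ LinearMap.ker L ↔ ∀ i, B (v i) x = 0 := fun x => by
      simp [hL, funext_iff]
    have hker : LinearMap.ker L ≠ ⊥ :=
      LinearMap.ker_ne_bot_of_finrank_lt (by rw [Module.finrank_fin_fun]; omega)
    obtain ⟨w, hw, hw0⟩ := Submodule.exists_mem_ne_zero_of_ne_bot hker
    obtain ⟨u, hu⟩ := hnd w hw0
    -- Project `u` to the orthogonal complement of the family.
    set u' := u - ∑ i, B (v i) u • v i with hu'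
    have hu'mem : u' ∈ LinearMap.ker L := (hLmem _).mpr fun j => by simp [hu', hv]
    have hu'w : B u' w ≠ 0 := by
      have h0 := (hLmem w).mp hw
      simpa [hu', h0] using hu
    obtain ⟨x, hx, hxx⟩ := exists_self_ne_zero hε B hu'mem hw hu'w
    obtain ⟨c, hc⟩ := hε.exists_norm (B x x)⁻¹ (by rw [map_inv₀, hB])
    have hx0 := (hLmem x).mp hx
    have hx0' : ∀ i, B x (v i) = 0 := fun i => by rw [← hB, hx0, map_zero]
    refine ⟨Fin.snoc v (c • x), fun i j => ?_⟩
    induction i using Fin.lastCases with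
    | last =>
      induction j using Fin.lastCases with
      | last =>
        simp only [Fin.snoc_last, map_smulₛₗ, LinearMap.smul_apply, smul_eq_mul, if_true]
        rw [RingHom.id_apply, mul_left_comm, ← mul_assoc, hc, inv_mul_cancel₀ hxx]
      | cast j => simp [hx0', (Fin.castSucc_lt_last j).ne']
    | cast i =>
      induction j using Fin.lastCases with
      | last => simp [hx0, (Fin.castSucc_lt_last i).ne]
      | cast j => simp [hv]

/-- The conjugate transpose of a matrix with respect to a field endomorphism `ε`. -/
def adj (ε : F →+* F) {N : ℕ} (A : Matrix (Fin N) (Fin N) F) : Matrix (Fin N) (Fin N) F :=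
  (A.map ε).transpose

variable {N : ℕ}

theorem adj_apply (A : Matrix (Fin N) (Fin N) F) (i j : Fin N) : adj ε A i j = ε (A j i) := rfl

theorem adj_mul (A B : Matrix (Fin N) (Fin N) F) : adj ε (A * B) = adj ε B * adj ε A := by
  rw [adj, Matrix.map_mul, Matrix.transpose_mul, adj, adj]

theorem adj_one : adj ε (1 : Matrix (Fin N) (Fin N) F) = 1 := by simp [adj]

theorem adj_zero : adj ε (0 : Matrix (Fin N) (Fin N) F) = 0 := by
  ext i j; simp [adj_apply]

theorem adj_add (A B : Matrix (Fin N) (Fin N) F) : adj ε (A + B) = adj ε A + adj ε B := by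
  ext i j; simp [adj_apply]

theorem adj_smul (c : F) (A : Matrix (Fin N) (Fin N) F) : adj ε (c • A) = ε c • adj ε A := by
  ext i j; simp [adj_apply]

theorem adj_adj (hε : IsQuadraticInvolution ε) (A : Matrix (Fin N) (Fin N) F) :
    adj ε (adj ε A) = A := by
  ext i j; simp [adj_apply, hε.invol]

/-- Over a finite field every invertible hermitian matrix is congruent to the identity. -/
theorem exists_adj_mul_self_eq (hε : IsQuadraticInvolution ε) {Y : Matrix (Fin N) (Fin N) F}
    (hY : IsUnit Y) (hherm : adj ε Y = Y) : ∃ P : GL (Fin N) F,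
      adj ε (P : Matrix (Fin N) (Fin N) F) * P = Y := by
  let B : (Fin N → F) →ₛₗ[ε] (Fin N → F) →ₗ[F] F := LinearMap.mk₂'ₛₗ ε (RingHom.id F)
    (fun v w => ∑ i, ∑ j, ε (v i) * Y i j * w j)
    (fun v v' w => by simp [add_mul, Finset.sum_add_distrib])
    (fun c v w => by simp [Finset.mul_sum, mul_assoc])
    (fun v w w' => by simp [mul_add, Finset.sum_add_distrib])
    (fun c v w => by simp [Finset.mul_sum, mul_left_comm])
  have hBdef : ∀ v w, B v w = ∑ i, ∑ j, ε (v i) * Y i j * w j := fun v w => rfl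
  have hYij : ∀ i j, ε (Y i j) = Y j i := fun i j => by
    conv_rhs => rw [← hherm]
    rfl
  have hB : ∀ x y, ε (B x y) = B y x := fun x y => by
    simp only [hBdef, map_sum, map_mul, hε.invol, hYij]
    rw [Finset.sum_comm]
    exact Finset.sum_congr rfl fun i _ => Finset.sum_congr rfl fun j _ => by ring
  have hnd : ∀ w ≠ 0, ∃ u, B u w ≠ 0 := by
    intro w hw
    by_contra! h
    apply hw
    have h0 : Y.mulVec w = 0 := by
      ext i
      have := h (Pi.single i 1)
      rw [hBdef, Finset.sum_eq_single i] at this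
      · simpa [Matrix.mulVec, dotProduct] using this
      · intro k _ hk
        simp [hk]
      · simp
    exact Matrix.mulVec_injective_of_isUnit hY (by rw [h0, Matrix.mulVec_zero])
  obtain ⟨v, hv⟩ := exists_orthonormal hε B hB hnd N (by rw [Module.finrank_fin_fun])
  set Q : Matrix (Fin N) (Fin N) F := Matrix.of fun i j => v j i with hQ
  have hQY : adj ε Q * Y * Q = 1 := by
    ext i j
    have := hv i j
    rw [hBdef, Finset.sum_comm] at this
    simp only [Matrix.mul_apply, adj_apply, Finset.sum_mul, Matrix.one_apply]
    exact this
  have hQu : IsUnit Q := IsUnit.of_mul_eq_one_right _ hQY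
  obtain ⟨U, hU⟩ := hQu
  refine ⟨U⁻¹, ?_⟩
  have h1 : adj ε Q * adj ε ((U⁻¹ : GL (Fin N) F) : Matrix (Fin N) (Fin N) F) = 1 := by
    rw [← adj_mul, ← hU, Units.inv_mul, adj_one]
  have h2 := mul_eq_one_comm.mp h1
  calc _ = adj ε ((U⁻¹ : GL (Fin N) F) : Matrix (Fin N) (Fin N) F) * (adj ε Q * Y * Q) *
        ((U⁻¹ : GL (Fin N) F) : Matrix (Fin N) (Fin N) F) := by rw [hQY, mul_one]
    _ = (adj ε ((U⁻¹ : GL (Fin N) F) : Matrix (Fin N) (Fin N) F) * adj ε Q) * Y *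
        (Q * ((U⁻¹ : GL (Fin N) F) : Matrix (Fin N) (Fin N) F)) := by simp only [mul_assoc]
    _ = Y := by rw [h2, ← hU, Units.mul_inv, one_mul, mul_one]

end HermitianForm

/-! ### Absolutely irreducible representations -/

/-- Burnside's theorem. -/
theorem asAlgebraHom_surjective_of_isIrreducible {K G V : Type*} [Field K] [IsAlgClosed K]
    [Group G] [AddCommGroup V] [Module K V] [FiniteDimensional K V] (π : Representation K G V)
    (hπ : π.IsIrreducible) : Function.Surjective π.asAlgebraHom := by
  intro φ
  let f : Module.End (Module.End (MonoidAlgebra K G) π.asModule) π.asModule :=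
    { toFun := fun v => π.asModuleEquiv.symm (φ (π.asModuleEquiv v))
      map_add' := fun v w => by simp
      map_smul' := fun c v => by
        -- By Schur's lemma the commutant consists of scalars.
        obtain ⟨t, rfl⟩ :=
          (IsSimpleModule.algebraMap_end_bijective_of_isAlgClosed (A := MonoidAlgebra K G)
            (V := π.asModule) K).2 c
        simp }
  classical
  obtain ⟨s, hs⟩ := Module.Finite.fg_top (R := K) (M := V)
  obtain ⟨r, hr⟩ := jacobson_density f (s.image π.asModuleEquiv.symm)
  refine ⟨r, LinearMap.ext_on hs fun v hv => ?_⟩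
  have := hr (π.asModuleEquiv.symm v) (Finset.mem_image_of_mem _ hv)
  apply_fun π.asModuleEquiv at this
  rw [Representation.asModuleEquiv_map_smul] at this
  simpa [f] using this.symm

/-- The image of an absolutely irreducible representation spans the matrix algebra, already over
the field of definition. -/
theorem IsAbsolutelyIrreducible.span_eq_top {G F : Type*} [Group G] [Field F] {N : ℕ}
    {R : G →* GL (Fin N) F} (hR : IsAbsolutelyIrreducible R) :
    Submodule.span F (Set.range fun g => (R g : Matrix (Fin N) (Fin N) F)) = ⊤ := by
  set K := AlgebraicClosure F
  set S := (Matrix.GeneralLinearGroup.map (algebraMap F K)).comp R with hS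
  by_contra hne
  obtain ⟨l, hl0, hl⟩ := Submodule.exists_le_ker_of_lt_top _ (lt_top_iff_ne_top.mpr hne)
  -- The functional `l` extends to the matrices over the algebraic closure.
  let L : Matrix (Fin N) (Fin N) K →ₗ[K] K :=
    ∑ i, ∑ j, algebraMap F K (l (Matrix.single i j 1)) • Matrix.entryLinearMap K K i j
  have hLA : ∀ A : Matrix (Fin N) (Fin N) F, L (A.map (algebraMap F K)) = algebraMap F K (l A) := by
    intro A
    conv_rhs => rw [Matrix.matrix_eq_sum_single A]
    simp only [L, LinearMap.sum_apply, LinearMap.smul_apply, Matrix.entryLinearMap_apply,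
      Matrix.map_apply, smul_eq_mul, map_sum]
    refine Finset.sum_congr rfl fun i _ => Finset.sum_congr rfl fun j _ => ?_
    rw [← map_mul, mul_comm, ← smul_eq_mul, ← map_smul, Matrix.smul_single, smul_eq_mul, mul_one]
  have hLS : ∀ g, L (S g : Matrix (Fin N) (Fin N) K) = 0 := fun g => by
    have : (S g : Matrix (Fin N) (Fin N) K) =
        (R g : Matrix (Fin N) (Fin N) F).map (algebraMap F K) := rfl
    rw [this, hLA]
    have : l (R g : Matrix (Fin N) (Fin N) F) = 0 := hl (Submodule.subset_span ⟨g, rfl⟩)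
    rw [this, map_zero]
  have hL0 : L = 0 := by
    ext1 A
    obtain ⟨r, hr⟩ := asAlgebraHom_surjective_of_isIrreducible _ hR (Matrix.toLinAlgEquiv' A)
    have key : ∀ r : MonoidAlgebra K G, L (Matrix.toLinAlgEquiv'.symm
        ((matrixRepresentation S).asAlgebraHom r)) = 0 := by
      intro r
      induction r using MonoidAlgebra.induction_on with
      | of g =>
        rw [Representation.asAlgebraHom_of]
        have : matrixRepresentation S g =
          Matrix.toLinAlgEquiv' (S g : Matrix (Fin N) (Fin N) K) := rfl
        rw [this, AlgEquiv.symm_apply_apply, hLS]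
      | add x y hx hy => rw [map_add, map_add, map_add, hx, hy, add_zero]
      | smul c x hx => rw [map_smul, map_smul, map_smul, hx, smul_zero]
    have := key r
    rw [hr, AlgEquiv.symm_apply_apply] at this
    rw [this, LinearMap.zero_apply]
  apply hl0
  ext1 A
  have := hLA A
  rw [hL0, LinearMap.zero_apply] at this
  exact (map_eq_zero (algebraMap F K)).mp this.symm

/-! ### The conjugate dual of a Hecke representation -/

theorem map_trace_eq_of_isIdempotentElem {F : Type*} [Field F] (ε : F →+* F) {N : ℕ}
    {E : Matrix (Fin N) (Fin N) F} (hE : E * E = E) : ε E.trace = E.trace := by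
  have h : IsIdempotentElem (Matrix.toLin' E) := by
    rw [IsIdempotentElem, Module.End.mul_eq_comp, ← Matrix.toLin'_mul, hE]
  rw [← Matrix.trace_toLin'_eq, (LinearMap.IsIdempotentElem.isProj_range _ h).trace, map_natCast]

section ConjugateDual

variable {F : Type*} [Field F] {ε : F →+* F} {n N : ℕ} {α : Fˣ}

/-- Two representations of the Hecke algebra are conjugate dual if a braid `g` acts in the second
by the conjugate transpose of the action of `g⁻¹` in the first. -/
def IsConjugateDual (ε : F →+* F)
    (ρ ρ' : HeckeAlgebra F n α →ₐ[F] Matrix (Fin N) (Fin N) F) : Prop :=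
  ∀ g, ρ' (HeckeAlgebra.ofBraid F n α g) = adj ε (ρ (HeckeAlgebra.ofBraid F n α g⁻¹))

theorem IsConjugateDual.symm (hε : IsQuadraticInvolution ε)
    {ρ ρ' : HeckeAlgebra F n α →ₐ[F] Matrix (Fin N) (Fin N) F} (h : IsConjugateDual ε ρ ρ') :
    IsConjugateDual ε ρ' ρ := fun g => by rw [h, inv_inv, adj_adj hε]

/-- The quadratic relation is invariant under passage to the conjugate dual, because `ε` inverts
`α`. -/
theorem exists_isConjugateDual (hα : ε (α : F) = (α : F)⁻¹)
    (ρ : HeckeAlgebra F n α →ₐ[F] Matrix (Fin N) (Fin N) F) :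
    ∃ ρ' : HeckeAlgebra F n α →ₐ[F] Matrix (Fin N) (Fin N) F, IsConjugateDual ε ρ ρ' := by
  let R : BraidGroup n →* Matrix (Fin N) (Fin N) F :=
    { toFun := fun g => adj ε (ρ (HeckeAlgebra.ofBraid F n α g⁻¹))
      map_one' := by rw [inv_one, map_one, map_one, adj_one]
      map_mul' := fun g h => by rw [mul_inv_rev, map_mul, map_mul, adj_mul] }
  refine HeckeAlgebra.exists_algHom_of_monoidHom R fun i => ?_
  set t := ρ (HeckeAlgebra.ofBraid F n α (BraidGroup.σ i)) with ht
  set u := ρ (HeckeAlgebra.ofBraid F n α (BraidGroup.σ i)⁻¹) with hu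
  have hut : u * t = 1 := by rw [hu, ht, ← map_mul, ← map_mul, inv_mul_cancel, map_one, map_one]
  have hq : t * t = ((α : F) - 1) • t + (α : F) • 1 := by
    have := (HeckeAlgebra.quadratic_iff (α : F) _).mp
      (HeckeAlgebra.quad_relation (F := F) (α := α) i)
    rw [ht, ← map_mul, this]
    simp
  have h1 : t = ((α : F) - 1) • 1 + (α : F) • u := by
    have := congrArg (u * ·) hq
    simpa only [← mul_assoc, hut, one_mul, mul_add, mul_smul_comm, mul_one] using this
  have h2 : 1 = ((α : F) - 1) • u + (α : F) • (u * u) := by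
    have := congrArg (u * ·) h1
    simpa only [hut, mul_add, mul_smul_comm, mul_one] using this
  have h3 : 1 = ((α : F)⁻¹ - 1) • adj ε u + (α : F)⁻¹ • (adj ε u * adj ε u) := by
    have := congrArg (adj ε) h2
    rwa [adj_one, adj_add, adj_smul, adj_smul, adj_mul, map_sub, map_one, hα] at this
  rw [HeckeAlgebra.quadratic_iff]
  change adj ε u * adj ε u = ((α : F) - 1) • adj ε u + (α : F) • 1
  rw [h3, smul_add, smul_smul, smul_smul, mul_sub, mul_inv_cancel₀ α.ne_zero, mul_one, one_smul,
    ← add_assoc, ← add_smul]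
  simp

theorem IsConjugateDual.adj_mul_eq (hα : ε (α : F) = (α : F)⁻¹)
    {ρ ρ' : HeckeAlgebra F n α →ₐ[F] Matrix (Fin N) (Fin N) F} (h : IsConjugateDual ε ρ ρ')
    {l : ℕ} {E : HeckeAlgebra F n α}
    (hE : IsBlockIdempotent (α : F) (n - 1) (HeckeAlgebra.gen F n α)
      (Matrix (Fin N) (Fin N) F) l E) :
    adj ε (ρ E) * ρ' E = adj ε (ρ E) := by
  refine hE.mul_eq ρ' _ fun j hj hjE => ?_
  set s := HeckeAlgebra.ofBraid F n α (BraidGroup.σ ⟨j, hj⟩)⁻¹ with hs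
  have hsE : s * E = (α : F)⁻¹ • E := by
    have hst : s * HeckeAlgebra.gen F n α j = 1 := by
      rw [HeckeAlgebra.gen_of_lt hj, hs, ← map_mul, inv_mul_cancel, map_one]
    have := congrArg (s * ·) hjE
    simp only [← mul_assoc, hst, one_mul, mul_smul_comm] at this
    rw [this, smul_smul, inv_mul_cancel₀ α.ne_zero, one_smul, ← this]
  have hα' : ε (α : F)⁻¹ = (α : F) := by rw [map_inv₀, hα, inv_inv]
  rw [HeckeAlgebra.gen_of_lt hj, h, ← hs, ← adj_mul, ← map_mul, hsE, map_smul, adj_smul, hα']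

/-- A block idempotent projects onto the vectors on which certain generators act by `α`. On the
conjugate dual these generators act by the conjugate transposes of their inverses, so it acts
there by the conjugate transpose. -/
theorem IsConjugateDual.map_blockIdempotent (hε : IsQuadraticInvolution ε)
    (hα : ε (α : F) = (α : F)⁻¹)
    {ρ ρ' : HeckeAlgebra F n α →ₐ[F] Matrix (Fin N) (Fin N) F} (h : IsConjugateDual ε ρ ρ')
    {l : ℕ} {E : HeckeAlgebra F n α}
    (hE : IsBlockIdempotent (α : F) (n - 1) (HeckeAlgebra.gen F n α)
      (Matrix (Fin N) (Fin N) F) l E) :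
    ρ' E = adj ε (ρ E) := by
  have h1 := h.adj_mul_eq hα hE
  have h2 := congrArg (adj ε) ((h.symm hε).adj_mul_eq hα hE)
  rw [adj_mul, adj_adj hε] at h2
  exact h2.symm.trans h1

/-- A representation of a semisimple Hecke algebra and its conjugate dual have the same
character. -/
theorem IsConjugateDual.trace_eq (hε : IsQuadraticInvolution ε) (hα : ε (α : F) = (α : F)⁻¹)
    (hss : IsSemisimpleRing (HeckeAlgebra F n α))
    {ρ ρ' : HeckeAlgebra F n α →ₐ[F] Matrix (Fin N) (Fin N) F} (h : IsConjugateDual ε ρ ρ')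
    (y : HeckeAlgebra F n α) : (ρ y).trace = (ρ' y).trace := by
  let f : HeckeAlgebra F n α →ₗ[F] F :=
    Matrix.traceLinearMap (Fin N) F F ∘ₗ (ρ.toLinearMap - ρ'.toLinearMap)
  have hf : ∀ y, f y = (ρ y).trace - (ρ' y).trace := fun y => by simp [f]
  have h0 := HeckeAlgebra.isHeckeFamily_gen.trace_eq_zero (B := Matrix (Fin N) (Fin N) F)
    (T := HeckeAlgebra.gen F n α) (fun i h1 h2 => HeckeAlgebra.qInt_ne_zero hss h1 h2) f
    (fun a b => by
      rw [hf, hf, map_mul, map_mul, map_mul, map_mul, Matrix.trace_mul_comm,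
        Matrix.trace_mul_comm (ρ' a)])
    (fun l E hE => by
      rw [hf, h.map_blockIdempotent hε hα hE, sub_eq_zero]
      have hid : ρ E * ρ E = ρ E := by rw [← map_mul, hE.idem]
      rw [← map_trace_eq_of_isIdempotentElem ε hid]
      simp [Matrix.trace, adj_apply])
    y (by rw [HeckeAlgebra.initialSubalgebra_gen]; trivial)
  rw [hf] at h0
  exact sub_eq_zero.mp h0

end ConjugateDual

/-! ### Representations with equal characters -/

section EqualCharacters

variable {F H : Type*} [Field F] [Ring H] [Algebra F H] {N : ℕ}

theorem map_eq_zero_of_trace_eq {ρ ρ' : H →ₐ[F] Matrix (Fin N) (Fin N) F}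
    (hρ' : Function.Surjective ρ') (htr : ∀ y, (ρ y).trace = (ρ' y).trace) {y : H}
    (hy : ρ y = 0) : ρ' y = 0 := by
  refine Matrix.ext_iff_trace_mul_right.mpr fun B => ?_
  obtain ⟨z, rfl⟩ := hρ' B
  rw [← map_mul, ← htr, map_mul, hy, zero_mul, zero_mul]

/-- Surjective matrix representations with equal characters are equivalent: they have the same
kernel because the trace form is nondegenerate, and all automorphisms of a matrix algebra are
inner. -/
theorem exists_conj_of_trace_eq {ρ ρ' : H →ₐ[F] Matrix (Fin N) (Fin N) F}
    (hρ : Function.Surjective ρ) (hρ' : Function.Surjective ρ')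
    (htr : ∀ y, (ρ y).trace = (ρ' y).trace) :
    ∃ X : GL (Fin N) F, ∀ y, ρ' y * X = X * ρ y := by
  have hker : ∀ y z, ρ y = ρ z ↔ ρ' y = ρ' z := fun y z => by
    rw [← sub_eq_zero, ← map_sub, ← sub_eq_zero (a := ρ' y), ← map_sub]
    exact ⟨map_eq_zero_of_trace_eq hρ' htr, map_eq_zero_of_trace_eq hρ fun y => (htr y).symm⟩
  choose s hs using hρ
  have hsρ : ∀ y, ρ' (s (ρ y)) = ρ' y := fun y => (hker _ _).mp (hs _)
  let Φ : Matrix (Fin N) (Fin N) F →ₐ[F] Matrix (Fin N) (Fin N) F := AlgHom.ofLinearMap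
    { toFun := fun A => ρ' (s A)
      map_add' := fun A B => by rw [← map_add, ← hker, map_add, hs, hs, hs]
      map_smul' := fun c A => by
        rw [RingHom.id_apply, ← map_smul, ← hker, map_smul, hs, hs] }
    (by change ρ' (s 1) = 1; rw [(hker _ 1).mp (by rw [hs, map_one]), map_one])
    (fun A B => by change ρ' (s (A * B)) = ρ' (s A) * ρ' (s B)
                   rw [← map_mul, ← hker, map_mul, hs, hs, hs])
  have hΦ : ∀ y, Φ (ρ y) = ρ' y := hsρ
  have hbij : Function.Bijective Φ := by
    refine ⟨fun A B hAB => ?_, fun B => ?_⟩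
    · rw [← hs A, ← hs B]; exact (hker _ _).mpr hAB
    · obtain ⟨y, rfl⟩ := hρ' B
      exact ⟨ρ y, hΦ y⟩
  obtain ⟨U, hU⟩ := AlgEquiv.eq_linearEquivConjAlgEquiv
    ((Matrix.toLinAlgEquiv'.symm.trans (AlgEquiv.ofBijective Φ hbij)).trans
      Matrix.toLinAlgEquiv' : Module.End F (Fin N → F) ≃ₐ[F] Module.End F (Fin N → F))
  refine ⟨⟨LinearMap.toMatrix' U.toLinearMap, LinearMap.toMatrix' U.symm.toLinearMap, ?_, ?_⟩,
    fun y => ?_⟩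
  · rw [← LinearMap.toMatrix'_comp]; simp
  · rw [← LinearMap.toMatrix'_comp]; simp
  · have h1 := congrArg (fun g => g (Matrix.toLinAlgEquiv' (ρ y))) hU
    simp only [AlgEquiv.trans_apply, AlgEquiv.symm_apply_apply, AlgEquiv.ofBijective_apply, hΦ] at h1
    apply Matrix.toLin'.injective
    change Matrix.toLin' (ρ' y * LinearMap.toMatrix' U.toLinearMap) =
      Matrix.toLin' (LinearMap.toMatrix' U.toLinearMap * ρ y)
    rw [Matrix.toLin'_mul, Matrix.toLin'_mul, Matrix.toLin'_toMatrix']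
    have h2 : Matrix.toLin' (ρ' y) = U.conjAlgEquiv F (Matrix.toLin' (ρ y)) := h1
    rw [h2]
    ext v
    simp [LinearEquiv.conjAlgEquiv_apply]

end EqualCharacters

theorem adj_span_eq_top {F : Type*} [Field F] {ε : F →+* F} (hε : IsQuadraticInvolution ε) {N : ℕ}
    {ι : Type*} {A : ι → Matrix (Fin N) (Fin N) F} (hA : Submodule.span F (Set.range A) = ⊤) :
    Submodule.span F (Set.range fun i => adj ε (A i)) = ⊤ := by
  rw [eq_top_iff]
  rintro B -
  have hB : adj ε B ∈ Submodule.span F (Set.range A) := by rw [hA]; trivial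
  rw [← adj_adj hε B]
  generalize adj ε B = C at hB ⊢
  induction hB using Submodule.span_induction with
  | mem x hx => obtain ⟨i, rfl⟩ := hx; exact Submodule.subset_span ⟨i, rfl⟩
  | zero => rw [adj_zero]; exact zero_mem _
  | add x y _ _ hx hy => rw [adj_add]; exact add_mem hx hy
  | smul c x _ hx => rw [adj_smul]; exact Submodule.smul_mem _ _ hx

/-- A family of matrices which spans the matrix algebra and preserves a nondegenerate sesquilinear
form also preserves a nondegenerate hermitian one: by Schur's lemma the form is proportional to its
conjugate transpose, so it can be rescaled. -/
theorem exists_hermitian_invariant {F : Type*} [Field F] {ε : F →+* F}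
    (hε : IsQuadraticInvolution ε) {N : ℕ} {ι : Type*} {A : ι → Matrix (Fin N) (Fin N) F}
    (hA : Submodule.span F (Set.range A) = ⊤) (X : GL (Fin N) F)
    (hX : ∀ i, adj ε (A i) * X * A i = X) :
    ∃ Y : Matrix (Fin N) (Fin N) F, IsUnit Y ∧ adj ε Y = Y ∧ ∀ i, adj ε (A i) * Y * A i = Y := by
  set M : Matrix (Fin N) (Fin N) F := (X : Matrix (Fin N) (Fin N) F) with hM
  have hXinv : ((X⁻¹ : GL (Fin N) F) : Matrix (Fin N) (Fin N) F) * M = 1 := X.inv_mul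
  have hXinv' : M * ((X⁻¹ : GL (Fin N) F) : Matrix (Fin N) (Fin N) F) = 1 := X.mul_inv
  set Z := ((X⁻¹ : GL (Fin N) F) : Matrix (Fin N) (Fin N) F) * adj ε M with hZ
  have hMZ : M * Z = adj ε M := by rw [hZ, ← mul_assoc, hXinv', one_mul]
  have hMs : ∀ i, adj ε (A i) * adj ε M * A i = adj ε M := fun i => by
    have := congrArg (adj ε) (hX i)
    rwa [adj_mul, adj_mul, adj_adj hε, ← mul_assoc] at this
  have hcomm : ∀ B : Matrix (Fin N) (Fin N) F, B * Z = Z * B := by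
    intro B
    have hB : B ∈ Submodule.span F (Set.range A) := by rw [hA]; trivial
    induction hB using Submodule.span_induction with
    | mem x hx =>
      obtain ⟨i, rfl⟩ := hx
      -- Cancel the invertible matrix `adj ε (A i) * M` on the left.
      have hinv : IsUnit (adj ε (A i) * M) := by
        refine IsUnit.of_mul_eq_one (A i * ((X⁻¹ : GL (Fin N) F) : Matrix (Fin N) (Fin N) F)) ?_
        rw [← mul_assoc, hX, hXinv']
      refine hinv.mul_left_cancel ?_
      rw [← mul_assoc, hX, hMZ, ← mul_assoc, mul_assoc _ M, hMZ, hMs]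
    | zero => simp
    | add x y _ _ hx hy => rw [add_mul, mul_add, hx, hy]
    | smul c x _ hx => rw [smul_mul_assoc, mul_smul_comm, hx]
  obtain ⟨c, hc⟩ : ∃ c : F, c • 1 = Z := by
    obtain ⟨c, hc⟩ := Matrix.mem_range_scalar_of_commute_single
      (M := Z) (fun i j _ => hcomm (Matrix.single i j 1))
    exact ⟨c, by rw [← hc]; ext i j; simp [Matrix.one_apply, Matrix.diagonal_apply]⟩
  have hMc : adj ε M = c • M := by rw [← hMZ, ← hc, mul_smul_comm, mul_one]
  -- Some multiple of `M` plus its conjugate transpose is nonzero.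
  have hfin : ∃ t : F, t + ε t * c ≠ 0 := by
    by_contra! h
    have h1 := h 1
    rw [map_one, one_mul] at h1
    obtain ⟨x, hx⟩ := hε.nontriv
    apply hx
    linear_combination -(h x) + ε x * h1
  obtain ⟨t, ht⟩ := hfin
  refine ⟨(t + ε t * c) • M, ?_, ?_, fun i => ?_⟩
  · exact (X.isUnit).smul (Units.mk0 _ ht)
  · have h1 : (t + ε t * c) • M = t • M + adj ε (t • M) := by
      rw [adj_smul, hMc, smul_smul, add_smul]
    rw [h1, adj_add, adj_adj hε, add_comm]
  · rw [mul_smul_comm, smul_mul_assoc, hX]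

/-! ### Unitarity of Hecke representations -/

theorem mainTheorem4 {p : ℕ} [Fact p.Prime] {F : Type*} [Field F] [Finite F] [CharP F p]
    [Algebra (ZMod p) F] (α : Fˣ)
    (hgen : IntermediateField.adjoin (ZMod p) {(α : F)} = ⊤)
    (hne : IntermediateField.adjoin (ZMod p) {(α : F) + (α : F)⁻¹} ≠
      IntermediateField.adjoin (ZMod p) {(α : F)})
    (n : ℕ) (hn : 1 ≤ n) (hss : IsSemisimpleRing (HeckeAlgebra F n α))
    (N : ℕ) (R : BraidGroup n →* GL (Fin N) F)
    (hR : IsHeckeRepresentation α R) (hirr : IsAbsolutelyIrreducible R) :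
    ∃ f : ℕ, Nat.card F = (p ^ f) ^ 2 ∧
      ∃ P : GL (Fin N) F, ∀ g : BraidGroup n,
        P * R g * P⁻¹ ∈ generalUnitaryGroup N (iterateFrobenius F p f) := by
  obtain ⟨f, hf, hα⟩ := exists_iterateFrobenius_eq_inv α hgen hne
  refine ⟨f, hf, ?_⟩
  have hε := isQuadraticInvolution_iterateFrobenius hf
  set ε := iterateFrobenius F p f
  obtain ⟨ρ, hρ⟩ := hR
  obtain ⟨ρ', hdual⟩ := exists_isConjugateDual hα ρ
  have hspan := hirr.span_eq_top
  have hρs : Function.Surjective ρ := by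
    have : LinearMap.range ρ.toLinearMap = ⊤ := by
      rw [eq_top_iff, ← hspan, Submodule.span_le]
      rintro _ ⟨g, rfl⟩
      exact ⟨_, hρ g⟩
    exact LinearMap.range_eq_top.mp this
  have hρs' : Function.Surjective ρ' := by
    have : LinearMap.range ρ'.toLinearMap = ⊤ := by
      rw [eq_top_iff, ← adj_span_eq_top hε hspan, Submodule.span_le]
      rintro _ ⟨g, rfl⟩
      refine ⟨HeckeAlgebra.ofBraid F n α g⁻¹, ?_⟩
      rw [AlgHom.toLinearMap_apply, hdual, inv_inv, hρ]
    exact LinearMap.range_eq_top.mp this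
  obtain ⟨X, hX⟩ := exists_conj_of_trace_eq hρs hρs' (hdual.trace_eq hε hα hss)
  have hXinv : ∀ g, adj ε (R g : Matrix (Fin N) (Fin N) F) * X *
      (R g : Matrix (Fin N) (Fin N) F) = X := fun g => by
    have := hX (HeckeAlgebra.ofBraid F n α g⁻¹)
    rw [hdual, inv_inv, hρ, hρ] at this
    rw [this, mul_assoc, ← Units.val_mul, ← map_mul, inv_mul_cancel, map_one, Units.val_one,
      mul_one]
  obtain ⟨Y, hYu, hYh, hY⟩ := exists_hermitian_invariant hε hspan X hXinv
  obtain ⟨P, hP⟩ := exists_adj_mul_self_eq hε hYu hYh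
  refine ⟨P, fun g => ?_⟩
  change adj ε ((P * R g * P⁻¹ : GL (Fin N) F) : Matrix (Fin N) (Fin N) F) *
    ((P * R g * P⁻¹ : GL (Fin N) F) : Matrix (Fin N) (Fin N) F) = 1
  have hg := hY g
  rw [← hP] at hg
  have hPP : adj ε ((P⁻¹ : GL (Fin N) F) : Matrix (Fin N) (Fin N) F) *
      adj ε (P : Matrix (Fin N) (Fin N) F) = 1 := by
    rw [← adj_mul, Units.mul_inv, adj_one]
  rw [Units.val_mul, Units.val_mul, adj_mul, adj_mul]
  calc _ = adj ε ((P⁻¹ : GL (Fin N) F) : Matrix (Fin N) (Fin N) F) *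
        (adj ε (R g : Matrix (Fin N) (Fin N) F) * (adj ε (P : Matrix (Fin N) (Fin N) F) * P) *
          (R g : Matrix (Fin N) (Fin N) F)) *
        ((P⁻¹ : GL (Fin N) F) : Matrix (Fin N) (Fin N) F) := by simp only [mul_assoc]
    _ = (adj ε ((P⁻¹ : GL (Fin N) F) : Matrix (Fin N) (Fin N) F) *
        adj ε (P : Matrix (Fin N) (Fin N) F)) * (P *
        ((P⁻¹ : GL (Fin N) F) : Matrix (Fin N) (Fin N) F)) := by rw [hg]; simp only [mul_assoc]
    _ = 1 := by rw [hPP, Units.mul_inv, one_mul]
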